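/- Let $\Gamma\subset\mathbb C$ be a lattice, $M=\mathbb C/\Gamma$, and let $I:M\to M$ be an antiholomorphic involution without fixed points. Then there are $r>0$ and, with $\tau=ir$ and $\Gamma_r=\mathbb Z+\mathbb Z\tau$, a biholomorphic map $\varphi:M\to M_r=\mathbb C/\Gamma_r$ onto the torus of this rectangular lattice such that $\varphi\circ I\circ\varphi^{-1}([z])=[\bar z+\tfrac12]$ for all $z\in\mathbb C$, and such that the following holds. Let $\Lambda_0$ be the set of all $b=(b_1,\dots,b_4)\in\mathbb C^4$ with $b_k\in[0,1]\times[0,\operatorname{Im}\tau]$ for all $k$, with $i\sum_{k=1}^4\operatorname{Im} b_k=\frac{2l+1}{2}\tau$ for some $l\in\mathbb Z$, and with $b_j\not\equiv\bar b_k+\frac12 \pmod{\Gamma_r}$ for all $j,k$. Let $\sigma(z)=z\prod_{0\ne\omega\in\Gamma_r}\left(1-\frac z\omega\right)e^{\frac z\omega+\frac12(\frac z\omega)^2}$ be the Weierstrass sigma function of $\Gamma_r$, let $\zeta=\sigma'/\sigma$, and for $\omega\in\Gamma_r$ let $\eta(\omega)=\zeta(z+\omega)-\zeta(z)$ (which does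 not depend on $z\in\mathbb C\setminus\Gamma_r$). Then $\Lambda_0\neq\emptyset$, and there is a family of meromorphic functions $g_b:M\to\mathbb C\cup\{\infty\}=\mathbb S^2$, $b\in\Lambda_0$, such that for every $b\in\Lambda_0$: the degree of $g_b$ (its number of poles, counted with multiplicity) is $4$; $g_b\circ I=-1/\bar g_b$ on $M$, where $w\mapsto-1/\bar w$ is the antipodal map of $\mathbb S^2$, which exchanges $0$ and $\infty$; and $$g_b\big(\varphi^{-1}([z])\big)=e^{-\frac{\eta(1)}{2}\left(1+\sum_{k=1}^4\operatorname{Re} b_k\right)}\,e^{-\eta(\omega_0)z}\,\frac{\prod_{k=1}^4\sigma\left(z-\bar b_k-\frac12\right)}{\prod_{k=1}^4\sigma(z-b_k)},\qquad \omega_0=\sum_{k=1}^4 b_k-\sum_{k=1}^4\left(\bar b_k+\tfrac12\right)\in\Gamma_r,$$ for all $z\in\mathbb C$ not congruent to any $b_k$ modulo $\Gamma_r$, while $g_b(\varphi^{-1}([b_k]))=\infty$ for $k=1,\dots,4$. -/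

import Mathlib

open scoped Topology ComplexConjugate

noncomputable section

/-- The complex torus `ℂ / Γ`, where `Γ` is the lattice generated by the two `ℝ`-linearly
independent periods of `L`. -/
abbrev Torus (L : PeriodPair) : Type := ℂ ⧸ L.lattice

/-- The projection `z ↦ [z]` of `ℂ` onto `ℂ / Γ`. Its local inverses are the holomorphic charts of
the torus, so that holomorphy of maps from or to a torus is tested on local lifts to `ℂ`. -/
def toTorus (L : PeriodPair) (z : ℂ) : Torus L := L.lattice.mkQ z

/-- A map between tori is holomorphic: near each point it lifts to a holomorphic function `F`,
`f [z] = [F z]`. -/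
def IsHolomorphicTorusMap {L L' : PeriodPair} (f : Torus L → Torus L') : Prop :=
  ∀ z₀ : ℂ, ∃ F : ℂ → ℂ, AnalyticAt ℂ F z₀ ∧
    ∀ᶠ z in 𝓝 z₀, f (toTorus L z) = toTorus L' (F z)

/-- A map between tori is antiholomorphic: near each point it lifts to a holomorphic function of
the conjugate variable, `f [z] = [F (conj z)]`. -/
def IsAntiholomorphicTorusMap {L L' : PeriodPair} (f : Torus L → Torus L') : Prop :=
  ∀ z₀ : ℂ, ∃ F : ℂ → ℂ, AnalyticAt ℂ F (conj z₀) ∧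
    ∀ᶠ z in 𝓝 z₀, f (toTorus L z) = toTorus L' (F (conj z))

/-- A biholomorphic map between tori. -/
def IsBiholomorphic {L L' : PeriodPair} (φ : Torus L ≃ Torus L') : Prop :=
  IsHolomorphicTorusMap φ ∧ IsHolomorphicTorusMap φ.symm

/-- The generating pair is `(1, τ)` with `τ = i r`, `r > 0`: the lattice is rectangular. -/
structure IsRectangular (R : PeriodPair) : Prop where
  omega_one : R.ω₁ = 1
  re_tau : R.ω₂.re = 0
  im_tau : 0 < R.ω₂.im

/-- The involution `z ↦ 1 / z` of the Riemann sphere `ℂ ∪ {∞}`. -/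
def sphereInv (w : OnePoint ℂ) : OnePoint ℂ :=
  OnePoint.elim w ((0 : ℂ) : OnePoint ℂ)
    (fun z => if z = 0 then OnePoint.infty else ((z⁻¹ : ℂ) : OnePoint ℂ))

/-- The antipodal map `w ↦ -1 / conj w` of the Riemann sphere; it exchanges `0` and `∞`. -/
def sphereAntipode (w : OnePoint ℂ) : OnePoint ℂ :=
  OnePoint.elim w ((0 : ℂ) : OnePoint ℂ)
    (fun z => if z = 0 then OnePoint.infty else ((-(1 / conj z) : ℂ) : OnePoint ℂ))

/-- A meromorphic function on a torus: a holomorphic map to the Riemann sphere (near each point,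
`g` or `1 / g` is given by a holomorphic function of the coordinate) that is not constantly `∞`. -/
def IsMeromorphicOnTorus {L : PeriodPair} (g : Torus L → OnePoint ℂ) : Prop :=
  (∀ z₀ : ℂ, ∃ F : ℂ → ℂ, AnalyticAt ℂ F z₀ ∧
    ((∀ᶠ z in 𝓝 z₀, g (toTorus L z) = ((F z : ℂ) : OnePoint ℂ)) ∨
      (∀ᶠ z in 𝓝 z₀, g (toTorus L z) = sphereInv ((F z : ℂ) : OnePoint ℂ)))) ∧
  ∃ p, g p ≠ OnePoint.infty

/-- The doubly periodic function on `ℂ` induced by `g`, with the irrelevant value `0` at poles. -/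
def pullbackToPlane {L : PeriodPair} (g : Torus L → OnePoint ℂ) (z : ℂ) : ℂ :=
  OnePoint.elim (g (toTorus L z)) 0 id

/-- The order of the pole of `g` at `p` (`0` if `p` is not a pole). By periodicity it can be
computed at any representative of `p`. -/
def poleOrder {L : PeriodPair} (g : Torus L → OnePoint ℂ) (p : Torus L) : ℕ :=
  (-(meromorphicOrderAt (pullbackToPlane g) (Quotient.out p)).untop₀).toNat

/-- The degree of a meromorphic function on a torus (an elliptic function): the number of its
poles, counted with multiplicity. -/
def torusDegree {L : PeriodPair} (g : Torus L → OnePoint ℂ) : ℕ :=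
  ∑ᶠ p : Torus L, poleOrder g p

/-- The Weierstrass sigma function
`σ(z) = z ∏_{0 ≠ ω ∈ Γ} (1 - z/ω) exp (z/ω + (z/ω)²/2)`. -/
def weierstrassSigma (L : PeriodPair) (z : ℂ) : ℂ :=
  z * ∏' ω : {ω : L.lattice // ω ≠ 0},
    (1 - z / (ω : ℂ)) * Complex.exp (z / (ω : ℂ) + 1 / 2 * (z / (ω : ℂ)) ^ 2)

/-- The Weierstrass zeta function `ζ = σ' / σ`. -/
def weierstrassZeta (L : PeriodPair) (z : ℂ) : ℂ := logDeriv (weierstrassSigma L) z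

/-- The quasi-period homomorphism `η(ω) = ζ(z + ω) - ζ(z)`, `ω ∈ Γ`. The difference does not depend
on `z ∉ Γ`; it is taken at the half period `z = ω₁ / 2`, which is never in `Γ`. -/
def weierstrassEta (L : PeriodPair) (ω : ℂ) : ℂ :=
  weierstrassZeta L (L.ω₁ / 2 + ω) - weierstrassZeta L (L.ω₁ / 2)

/-- The set of admissible parameters for the rectangular lattice generated by `(1, τ)`: quadruples
`b₁, …, b₄` in `[0,1] × [0, Im τ]` with `i ∑ Im b_k = (2l+1)/2 · τ` for an integer `l`, such that no
`b_j` is congruent to a point `conj b_k + 1/2` modulo the lattice. -/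
def admissibleParameters (R : PeriodPair) : Set (Fin 4 → ℂ) :=
  {b | (∀ k, (b k).re ∈ Set.Icc (0 : ℝ) 1 ∧ (b k).im ∈ Set.Icc (0 : ℝ) R.ω₂.im) ∧
    (∃ l : ℤ, Complex.I * ∑ k, ((b k).im : ℂ) = (2 * (l : ℂ) + 1) / 2 * R.ω₂) ∧
    ∀ j k, toTorus R (b j) ≠ toTorus R (conj (b k) + 1 / 2)}

/-- `c e^{-η(ω₀) z} ∏ σ(z - conj b_k - 1/2) / ∏ σ(z - b_k)` with
`ω₀ = ∑ b_k - ∑ (conj b_k + 1/2)` and `c = e^{-η(1)/2 · (1 + ∑ Re b_k)}`. -/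
def sigmaQuotient (R : PeriodPair) (b : Fin 4 → ℂ) (z : ℂ) : ℂ :=
  Complex.exp (-(weierstrassEta R 1 / 2) * (1 + ∑ k, ((b k).re : ℂ))) *
    Complex.exp (-weierstrassEta R (∑ k, b k - ∑ k, (conj (b k) + 1 / 2)) * z) *
    ((∏ k, weierstrassSigma R (z - conj (b k) - 1 / 2)) / ∏ k, weierstrassSigma R (z - b k))

open Classical in
/-- The map `ℂ → ℂ ∪ {∞}` given by the sigma quotient, with value `∞` at the points congruent to
some `b_k`. -/
def sigmaMap (R : PeriodPair) (b : Fin 4 → ℂ) (z : ℂ) : OnePoint ℂ :=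
  if ∃ k, toTorus R z = toTorus R (b k) then OnePoint.infty
  else ((sigmaQuotient R b z : ℂ) : OnePoint ℂ)

end

/-!
An antiholomorphic self-map of `ℂ / Γ` is affine: the derivatives of its local lifts in the
conjugate variable glue to an entire function with a full lattice of periods, which is constant by
Liouville's theorem (`IsAntiholomorphicTorusMap.exists_affine`). So `I [z] = [a conj z + β]`. Being
an involution forces `|a| = 1`, and after rotating by a square root `u` of `a` the lattice
`Λ = u⁻¹ Γ` is stable under conjugation and the involution is `x ↦ conj x + δ`, where `2 Re δ ∈ Λ`.
It has no fixed points exactly if no point of `Λ` has real part `Re δ`, and this excludes rhombic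
lattices (`exists_rectangular_generators`). Scaling and a translation give the normal form
`w ↦ conj w + 1/2` on the torus of a rectangular lattice (`exists_rectangular_coordinate`).

The sigma function is a locally uniform limit of finite products. Comparing second logarithmic
derivatives gives `ζ' = -℘` (`deriv_weierstrassZeta`), so the periodicity of `℘` makes `ζ`
additively quasi-periodic, and `σ` quasi-periodic up to exponentials; oddness of `σ` determines the
constants, `σ(z + ω) = -exp (η(ω) (z + ω / 2)) σ(z)` whenever `ω / 2` is not a period
(`weierstrassSigma_add`). Computing `σ(z + ω₁ + ω₂)` in two ways gives the Legendre relation in the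
form `exp ((η(ω₁) ω₂ - η(ω₂) ω₁) / 2) = -1` (`exp_legendre`). This exponential form is all that is
needed, so no contour integral occurs.

For admissible `b` one has `ω₀ = (2l + 1) τ - 2`. The multipliers of the sigma quotient under
translations by periods are even powers of the Legendre exponential, so the quotient is elliptic
(`sigmaQuotient_periodic`). Since `σ (conj z) = conj (σ z)` on a rectangular lattice, the involution
`z ↦ conj z + 1/2` exchanges numerator and denominator up to exponentials, and the product
`f (conj z + 1/2) * conj (f z)` is the odd power `2l + 1` of the Legendre exponential, that is `-1`
(`sigmaQuotient_conj_add_half`). As `σ` has simple zeros exactly at the lattice points and numerator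
and denominator have no common zeros, the poles are the `b_k`, counted with multiplicity.
-/

noncomputable section

open Complex Filter Set

section

/-! ### The elementary factors of the sigma function -/

/-- The Weierstrass elementary factor of genus two, `(1 - u) exp (u + u² / 2)`. -/
def elementaryFactor (u : ℂ) : ℂ := (1 - u) * exp (u + 1 / 2 * u ^ 2)

lemma hasDerivAt_elementaryFactor (u : ℂ) :
    HasDerivAt elementaryFactor (-(u ^ 2 * exp (u + 1 / 2 * u ^ 2))) u := by
  have h1 : HasDerivAt (fun u : ℂ ↦ u + 1 / 2 * u ^ 2) (1 + u) u := by
    convert! (hasDerivAt_id u).add (((hasDerivAt_id u).pow 2).const_mul (1 / 2 : ℂ)) using 1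
    simp
  convert! ((hasDerivAt_id u).const_sub 1).mul h1.cexp using 1
  simp only [id]
  ring

@[fun_prop]
lemma differentiable_elementaryFactor : Differentiable ℂ elementaryFactor :=
  fun u ↦ (hasDerivAt_elementaryFactor u).differentiableAt

lemma elementaryFactor_ne_zero {u : ℂ} (hu : u ≠ 1) : elementaryFactor u ≠ 0 :=
  mul_ne_zero (sub_ne_zero.2 hu.symm) (exp_ne_zero _)

@[simp] lemma elementaryFactor_zero : elementaryFactor 0 = 1 := by simp [elementaryFactor]

lemma norm_elementaryFactor_sub_one_le {u : ℂ} (hu : ‖u‖ ≤ 1) :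
    ‖elementaryFactor u - 1‖ ≤ 8 * ‖u‖ ^ 3 := by
  have key := (convex_closedBall (0 : ℂ) ‖u‖).norm_image_sub_le_of_norm_hasDerivWithin_le
    (f := elementaryFactor) (C := 8 * ‖u‖ ^ 2) (x := 0) (y := u)
    (fun x _ ↦ (hasDerivAt_elementaryFactor x).hasDerivWithinAt) ?_ (by simp) (by simp)
  · simpa [pow_succ, mul_assoc] using key
  · intro x hx
    have hx : ‖x‖ ≤ ‖u‖ := by simpa using hx
    -- the exponent has norm at most `2`, and `e² < 8`
    have he : ‖exp (x + 1 / 2 * x ^ 2)‖ ≤ 8 := by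
      have h2 : ‖x + 1 / 2 * x ^ 2‖ ≤ 2 := by
        refine (norm_add_le _ _).trans ?_
        simp only [norm_mul, norm_pow, norm_div, norm_one, Complex.norm_ofNat]
        nlinarith [norm_nonneg x]
      refine (norm_exp_le_exp_norm _).trans ((Real.exp_le_exp.2 h2).trans ?_)
      have h1 := Real.exp_one_lt_d9
      rw [show (2 : ℝ) = 1 + 1 by norm_num, Real.exp_add]
      nlinarith [Real.exp_pos 1]
    rw [norm_neg, norm_mul, norm_pow, mul_comm]
    gcongr

lemma logDeriv_elementaryFactor_div {z ω : ℂ} (hω : ω ≠ 0) (hz : z ≠ ω) :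
    logDeriv (fun z ↦ elementaryFactor (z / ω)) z = 1 / (z - ω) + 1 / ω + z / ω ^ 2 := by
  have hd := HasDerivAt.comp (h := fun z ↦ z / ω) z (hasDerivAt_elementaryFactor (z / ω))
    ((hasDerivAt_id' z).div_const ω)
  rw [Function.comp_def] at hd
  have h1 : z - ω ≠ 0 := sub_ne_zero.2 hz
  have h2 : ω - z ≠ 0 := sub_ne_zero.2 hz.symm
  rw [logDeriv_apply, hd.deriv, elementaryFactor]
  have h3 : 1 - z / ω ≠ 0 := by
    rw [ne_eq, sub_eq_zero, eq_comm, div_eq_one_iff_eq hω]; exact hz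
  have := exp_ne_zero (z / ω + 1 / 2 * (z / ω) ^ 2)
  rw [div_eq_iff (mul_ne_zero h3 this)]
  generalize exp (z / ω + 1 / 2 * (z / ω) ^ 2) = e
  field_simp
  ring

/-! ### The sigma function as an entire function -/

variable (L : PeriodPair)

/-- The partial product of the sigma function over a finite set of nonzero periods. -/
def sigmaPartialProduct (s : Finset {ω : L.lattice // ω ≠ 0}) (z : ℂ) : ℂ :=
  z * ∏ ω ∈ s, elementaryFactor (z / (ω : ℂ))

variable {L}

lemma coe_nonzero_period_ne_zero (ω : {ω : L.lattice // ω ≠ 0}) : ((ω : L.lattice) : ℂ) ≠ 0 := by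
  simpa using ω.2

lemma summable_inv_norm_period_pow_three :
    Summable fun ω : {ω : L.lattice // ω ≠ 0} ↦ ‖((ω : L.lattice) : ℂ)‖⁻¹ ^ 3 :=
  (ZLattice.summable_norm_pow_inv L.lattice 3 (by simp)).subtype _

lemma eventually_lt_norm_period (r : ℝ) :
    ∀ᶠ ω : {ω : L.lattice // ω ≠ 0} in cofinite, r < ‖((ω : L.lattice) : ℂ)‖ := by
  have h : ∀ᶠ ω : L.lattice in cofinite, r < ‖(ω : ℂ)‖ := by
    refine (isCompact_iff_finite.mp (isCompact_closedBall (0 : L.lattice) r)).subset ?_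
    intro l hl
    simpa using hl
  exact Subtype.val_injective.tendsto_cofinite.eventually h

lemma eventually_norm_elementaryFactor_sub_one_le (r : ℝ) :
    ∀ᶠ ω : {ω : L.lattice // ω ≠ 0} in cofinite, ∀ z : ℂ, ‖z‖ ≤ r →
      ‖elementaryFactor (z / (ω : ℂ)) - 1‖ ≤ 8 * r ^ 3 * ‖((ω : L.lattice) : ℂ)‖⁻¹ ^ 3 := by
  filter_upwards [eventually_lt_norm_period r] with ω hω z hz
  have hpos : 0 < ‖((ω : L.lattice) : ℂ)‖ := norm_pos_iff.2 (coe_nonzero_period_ne_zero ω)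
  refine (norm_elementaryFactor_sub_one_le ?_).trans ?_
  · rw [norm_div, div_le_one hpos]
    exact hz.trans hω.le
  · rw [norm_div, div_eq_mul_inv, mul_pow, ← mul_assoc]
    gcongr

lemma summable_norm_elementaryFactor_sub_one (z : ℂ) :
    Summable fun ω : {ω : L.lattice // ω ≠ 0} ↦ ‖elementaryFactor (z / (ω : ℂ)) - 1‖ := by
  refine .of_norm_bounded_eventually
    (summable_inv_norm_period_pow_three.mul_left (8 * ‖z‖ ^ 3)) ?_
  filter_upwards [eventually_norm_elementaryFactor_sub_one_le ‖z‖] with ω hω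
  simpa using hω z le_rfl

lemma multipliable_elementaryFactor (z : ℂ) :
    Multipliable fun ω : {ω : L.lattice // ω ≠ 0} ↦ elementaryFactor (z / (ω : ℂ)) := by
  simpa using multipliable_one_add_of_summable (summable_norm_elementaryFactor_sub_one (L := L) z)

lemma weierstrassSigma_eq (z : ℂ) : weierstrassSigma L z =
    z * ∏' ω : {ω : L.lattice // ω ≠ 0}, elementaryFactor (z / (ω : ℂ)) := rfl

lemma tendstoLocallyUniformlyOn_tprod_elementaryFactor :
    TendstoLocallyUniformlyOn
      (fun (s : Finset {ω : L.lattice // ω ≠ 0}) z ↦ ∏ ω ∈ s, elementaryFactor (z / (ω : ℂ)))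
      (fun z ↦ ∏' ω : {ω : L.lattice // ω ≠ 0}, elementaryFactor (z / (ω : ℂ))) atTop univ := by
  refine hasProdLocallyUniformlyOn_of_forall_compact isOpen_univ fun K _ hK ↦ ?_
  obtain ⟨r, hr⟩ := hK.isBounded.exists_norm_le
  have := Summable.hasProdUniformlyOn_one_add
    (f := fun (ω : {ω : L.lattice // ω ≠ 0}) z ↦ elementaryFactor (z / (ω : ℂ)) - 1) hK
    (summable_inv_norm_period_pow_three.mul_left (8 * r ^ 3))
    ((eventually_norm_elementaryFactor_sub_one_le r).mono fun ω hω z hz ↦ hω z (hr z hz))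
    (fun ω ↦ by
      have : Continuous elementaryFactor := differentiable_elementaryFactor.continuous
      fun_prop)
  simpa using this

lemma differentiable_tprod_elementaryFactor : Differentiable ℂ
    fun z ↦ ∏' ω : {ω : L.lattice // ω ≠ 0}, elementaryFactor (z / (ω : ℂ)) := by
  rw [← differentiableOn_univ]
  refine tendstoLocallyUniformlyOn_tprod_elementaryFactor.differentiableOn
    (.of_forall fun s ↦ ?_) isOpen_univ
  exact DifferentiableOn.fun_finsetProd fun ω _ ↦
    (differentiable_elementaryFactor.comp (by fun_prop)).differentiableOn

variable (L) in
lemma differentiable_weierstrassSigma : Differentiable ℂ (weierstrassSigma L) :=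
  differentiable_id.mul differentiable_tprod_elementaryFactor

lemma differentiable_sigmaPartialProduct (s : Finset {ω : L.lattice // ω ≠ 0}) :
    Differentiable ℂ (sigmaPartialProduct L s) :=
  differentiable_id.mul (Differentiable.fun_finsetProd fun ω _ ↦
    differentiable_elementaryFactor.comp (by fun_prop))

lemma tendstoLocallyUniformlyOn_sigmaPartialProduct :
    TendstoLocallyUniformlyOn (sigmaPartialProduct L) (weierstrassSigma L) atTop univ := by
  have h1 : TendstoLocallyUniformlyOn (fun (_ : Finset {ω : L.lattice // ω ≠ 0}) (z : ℂ) ↦ z)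
      (fun z ↦ z) atTop univ :=
    fun u hu x _ ↦ ⟨univ, univ_mem, .of_forall fun _ _ _ ↦ refl_mem_uniformity hu⟩
  exact h1.mul₀ tendstoLocallyUniformlyOn_tprod_elementaryFactor continuousOn_id
    differentiable_tprod_elementaryFactor.continuous.continuousOn

@[simp] lemma weierstrassSigma_zero : weierstrassSigma L 0 = 0 := by simp [weierstrassSigma]

lemma deriv_weierstrassSigma_zero : deriv (weierstrassSigma L) 0 = 1 := by
  have h := (hasDerivAt_id (0 : ℂ)).mul
    (differentiable_tprod_elementaryFactor (L := L) 0).hasDerivAt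
  exact (h.deriv).trans (by simp)

lemma weierstrassSigma_ne_zero {z : ℂ} (hz : z ∉ L.lattice) : weierstrassSigma L z ≠ 0 := by
  rw [weierstrassSigma_eq]
  refine mul_ne_zero (fun h ↦ hz (h ▸ zero_mem _)) ?_
  have := tprod_one_add_ne_zero_of_summable
    (f := fun ω : {ω : L.lattice // ω ≠ 0} ↦ elementaryFactor (z / (ω : ℂ)) - 1) (fun ω ↦ ?_)
    (summable_norm_elementaryFactor_sub_one z)
  · simpa using this
  · rw [add_sub_cancel]
    refine elementaryFactor_ne_zero fun h ↦ hz ?_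
    rw [div_eq_one_iff_eq (coe_nonzero_period_ne_zero ω)] at h
    exact h ▸ ω.1.2

@[simp] lemma weierstrassSigma_neg (z : ℂ) :
    weierstrassSigma L (-z) = -weierstrassSigma L z := by
  let e : {ω : L.lattice // ω ≠ 0} ≃ {ω : L.lattice // ω ≠ 0} :=
    (Equiv.neg L.lattice).subtypeEquiv (by simp)
  rw [weierstrassSigma_eq, weierstrassSigma_eq, ← e.tprod_eq, neg_mul]
  simp [e, neg_div_neg_eq]

/-! ### The zeta function and the quasi-periods -/

/-- Locally uniform convergence of entire functions carries over to the derivative of the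
logarithmic derivative, pointwise where the limit does not vanish. -/
lemma tendsto_deriv_logDeriv {ι : Type*} {p : Filter ι} {f : ι → ℂ → ℂ} {g : ℂ → ℂ} {x : ℂ}
    (hF : TendstoLocallyUniformlyOn f g p univ) (hf : ∀ n, Differentiable ℂ (f n))
    (hg : Differentiable ℂ g) (hx : g x ≠ 0) :
    Tendsto (fun n ↦ deriv (logDeriv (f n)) x) p (𝓝 (deriv (logDeriv g) x)) := by
  have formula {h : ℂ → ℂ} (hh : Differentiable ℂ h) (hhx : h x ≠ 0) :
      deriv (logDeriv h) x = (deriv (deriv h) x * h x - deriv h x * deriv h x) / h x ^ 2 :=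
    deriv_div (hh.deriv x) (hh x) hhx
  have h0 := hF.tendsto_at (mem_univ x)
  have hF1 := hF.deriv (.of_forall fun n ↦ (hf n).differentiableOn) isOpen_univ
  have h1 := hF1.tendsto_at (mem_univ x)
  have h2 := (hF1.deriv (.of_forall fun n ↦ (hf n).deriv.differentiableOn) isOpen_univ).tendsto_at
    (mem_univ x)
  rw [formula hg hx]
  refine (((h2.mul h0).sub (h1.mul h1)).div (h0.pow 2) (pow_ne_zero 2 hx)).congr' ?_
  filter_upwards [h0.eventually_ne hx] with n hn
  exact (formula (hf n) hn).symm

lemma logDeriv_sigmaPartialProduct (s : Finset {ω : L.lattice // ω ≠ 0}) {z : ℂ}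
    (hz : z ∉ L.lattice) :
    logDeriv (sigmaPartialProduct L s) z =
      1 / z + ∑ ω ∈ s, (1 / (z - (ω : ℂ)) + 1 / (ω : ℂ) + z / (ω : ℂ) ^ 2) := by
  have hz0 : z ≠ 0 := fun h ↦ hz (h ▸ zero_mem _)
  have hne (ω : {ω : L.lattice // ω ≠ 0}) : z ≠ (ω : ℂ) := fun h ↦ hz (h ▸ ω.1.2)
  have hfac (ω : {ω : L.lattice // ω ≠ 0}) : elementaryFactor (z / (ω : ℂ)) ≠ 0 := by
    refine elementaryFactor_ne_zero ?_
    rw [ne_eq, div_eq_one_iff_eq (coe_nonzero_period_ne_zero ω)]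
    exact hne ω
  have hd (ω : {ω : L.lattice // ω ≠ 0}) :
      Differentiable ℂ fun z ↦ elementaryFactor (z / (ω : ℂ)) :=
    differentiable_elementaryFactor.comp (by fun_prop)
  rw [show sigmaPartialProduct L s = fun z ↦ z * ∏ ω ∈ s, elementaryFactor (z / (ω : ℂ)) from rfl,
    logDeriv_mul z hz0 (Finset.prod_ne_zero_iff.2 fun ω _ ↦ hfac ω) differentiableAt_fun_id
    (DifferentiableAt.fun_finsetProd fun ω _ ↦ hd ω z), logDeriv_id']
  congr 1
  rw [logDeriv_prod (fun ω _ ↦ hfac ω) (fun ω _ ↦ hd ω z)]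
  exact Finset.sum_congr rfl fun ω _ ↦
    logDeriv_elementaryFactor_div (coe_nonzero_period_ne_zero ω) (hne ω)

lemma deriv_logDeriv_sigmaPartialProduct (s : Finset {ω : L.lattice // ω ≠ 0}) {z : ℂ}
    (hz : z ∉ L.lattice) :
    deriv (logDeriv (sigmaPartialProduct L s)) z =
      -(1 / z ^ 2) - ∑ ω ∈ s, (1 / (z - (ω : ℂ)) ^ 2 - 1 / (ω : ℂ) ^ 2) := by
  have hz0 : z ≠ 0 := fun h ↦ hz (h ▸ zero_mem _)
  have hne (ω : {ω : L.lattice // ω ≠ 0}) : z - (ω : ℂ) ≠ 0 :=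
    sub_ne_zero.2 fun h ↦ hz (h ▸ ω.1.2)
  have hev : logDeriv (sigmaPartialProduct L s) =ᶠ[𝓝 z]
      fun z ↦ z⁻¹ + ∑ ω ∈ s, ((z - (ω : ℂ))⁻¹ + 1 / (ω : ℂ) + z / (ω : ℂ) ^ 2) := by
    filter_upwards [L.isClosed_lattice.isOpen_compl.mem_nhds hz] with w hw
    simp [logDeriv_sigmaPartialProduct s hw]
  rw [hev.deriv_eq]
  have hterm (ω : {ω : L.lattice // ω ≠ 0}) :
      HasDerivAt (fun z ↦ (z - (ω : ℂ))⁻¹ + 1 / (ω : ℂ) + z / (ω : ℂ) ^ 2)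
        (-(1 / (z - (ω : ℂ)) ^ 2 - 1 / (ω : ℂ) ^ 2)) z := by
    convert! ((((hasDerivAt_id' z).sub_const (ω : ℂ)).inv (hne ω)).add_const (1 / (ω : ℂ))).add
      ((hasDerivAt_id' z).div_const ((ω : ℂ) ^ 2)) using 1
    ring
  have h := (hasDerivAt_inv hz0).add (HasDerivAt.fun_sum fun ω (_ : ω ∈ s) ↦ hterm ω)
  refine h.deriv.trans ?_
  rw [Finset.sum_neg_distrib, ← sub_eq_add_neg, one_div]

/-- The derivative of the zeta function is `-℘`; both sides are limits of the corresponding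
expressions for the finite partial products of the sigma function. -/
lemma deriv_weierstrassZeta {z : ℂ} (hz : z ∉ L.lattice) :
    deriv (weierstrassZeta L) z = -L.weierstrassP z := by
  have h1 := tendsto_deriv_logDeriv (tendstoLocallyUniformlyOn_sigmaPartialProduct (L := L))
    differentiable_sigmaPartialProduct (differentiable_weierstrassSigma L)
    (weierstrassSigma_ne_zero hz)
  have hS : HasSum (fun ω : {ω : L.lattice // ω ≠ 0} ↦ 1 / (z - ω) ^ 2 - 1 / (ω : ℂ) ^ 2)
      (L.weierstrassPExcept 0 z) := by
    have := L.hasSum_weierstrassPExcept 0 z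
    rw [← hasSum_subtype_iff_of_support_subset (s := {ω | ω ≠ 0})] at this
    · refine this.congr_fun fun ω ↦ ?_
      exact (if_neg (coe_nonzero_period_ne_zero ω)).symm
    · intro ω hω h
      simp [h] at hω
  have h2 : Tendsto (fun s ↦ deriv (logDeriv (sigmaPartialProduct L s)) z) atTop
      (𝓝 (-(1 / z ^ 2) - L.weierstrassPExcept 0 z)) := by
    simp_rw [deriv_logDeriv_sigmaPartialProduct _ hz]
    exact hS.const_sub _
  rw [show weierstrassZeta L = logDeriv (weierstrassSigma L) from rfl,
    tendsto_nhds_unique h1 h2, ← L.weierstrassPExcept_add 0]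
  simp
  ring

lemma differentiableAt_weierstrassZeta {z : ℂ} (hz : z ∉ L.lattice) :
    DifferentiableAt ℂ (weierstrassZeta L) z :=
  (differentiable_weierstrassSigma L).deriv.differentiableAt.div
    (differentiable_weierstrassSigma L z) (weierstrassSigma_ne_zero hz)

lemma isPreconnected_compl_lattice : IsPreconnected ((L.lattice : Set ℂ)ᶜ) :=
  (Set.Countable.isConnected_compl_of_one_lt_rank (by simp)
    (countable_of_Lindelof_of_discrete (X := L.lattice))).2

lemma add_period_notMem {z ω : ℂ} (hω : ω ∈ L.lattice) (hz : z ∉ L.lattice) :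
    z + ω ∉ L.lattice := by
  rwa [add_mem_cancel_right hω]

lemma differentiableAt_weierstrassZeta_comp_add {z ω : ℂ} (hω : ω ∈ L.lattice)
    (hz : z ∉ L.lattice) : DifferentiableAt ℂ (fun z ↦ weierstrassZeta L (z + ω)) z :=
  DifferentiableAt.fun_comp' z (differentiableAt_weierstrassZeta (add_period_notMem hω hz))
    (by fun_prop)

/-- The zeta function is quasi-periodic with quasi-period `η(ω)`. -/
lemma weierstrassZeta_add {z ω : ℂ} (hω : ω ∈ L.lattice) (hz : z ∉ L.lattice) :
    weierstrassZeta L (z + ω) = weierstrassZeta L z + weierstrassEta L ω := by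
  have hd : DifferentiableOn ℂ (fun z ↦ weierstrassZeta L (z + ω) - weierstrassZeta L z)
      (L.lattice : Set ℂ)ᶜ := fun w hw ↦
    ((differentiableAt_weierstrassZeta_comp_add hω hw).sub
      (differentiableAt_weierstrassZeta hw)).differentiableWithinAt
  have h := L.isClosed_lattice.isOpen_compl.is_const_of_deriv_eq_zero isPreconnected_compl_lattice
    hd (fun w hw ↦ ?_) hz L.ω₁_div_two_notMem_lattice
  · rw [weierstrassEta, ← h]
    ring
  · have h1 := differentiableAt_weierstrassZeta_comp_add hω hw
    refine (deriv_sub h1 (differentiableAt_weierstrassZeta hw)).trans ?_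
    rw [deriv_comp_add_const, deriv_weierstrassZeta hw,
      deriv_weierstrassZeta (add_period_notMem hω hw), L.weierstrassP_add_coe w ⟨ω, hω⟩]
    simp

lemma weierstrassEta_add {ω ω' : ℂ} (hω : ω ∈ L.lattice) (hω' : ω' ∈ L.lattice) :
    weierstrassEta L (ω + ω') = weierstrassEta L ω + weierstrassEta L ω' := by
  have h0 := L.ω₁_div_two_notMem_lattice
  have h1 := weierstrassZeta_add (add_mem hω hω') h0
  have h2 := weierstrassZeta_add hω' (add_period_notMem hω h0)
  have h3 := weierstrassZeta_add hω h0
  rw [← add_assoc] at h1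
  linear_combination h2 + h3 - h1

/-- The quasi-period map `η` of a lattice as an additive homomorphism. -/
def weierstrassEtaHom (L : PeriodPair) : L.lattice →+ ℂ :=
  AddMonoidHom.mk' (fun ω ↦ weierstrassEta L ω) fun ω ω' ↦ weierstrassEta_add ω.2 ω'.2

lemma weierstrassEta_zsmul_add_zsmul (m n : ℤ) {ω ω' : ℂ} (hω : ω ∈ L.lattice)
    (hω' : ω' ∈ L.lattice) : weierstrassEta L (m * ω + n * ω') =
      m * weierstrassEta L ω + n * weierstrassEta L ω' := by
  have h := map_add (weierstrassEtaHom L) (m • ⟨ω, hω⟩) (n • ⟨ω', hω'⟩)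
  rw [map_zsmul, map_zsmul] at h
  simpa [weierstrassEtaHom] using h

/-- The sigma function is quasi-periodic up to an exponential factor. -/
lemma exists_weierstrassSigma_add {ω : ℂ} (hω : ω ∈ L.lattice) :
    ∃ C : ℂ, C ≠ 0 ∧
      ∀ z, weierstrassSigma L (z + ω) = C * exp (weierstrassEta L ω * z) * weierstrassSigma L z := by
  have hσ := differentiable_weierstrassSigma L
  have hlog : EqOn (logDeriv fun z ↦ weierstrassSigma L (z + ω))
      (logDeriv fun z ↦ exp (weierstrassEta L ω * z) * weierstrassSigma L z)
      (L.lattice : Set ℂ)ᶜ := by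
    intro z hz
    have hexp : HasDerivAt (fun z ↦ exp (weierstrassEta L ω * z))
        (exp (weierstrassEta L ω * z) * weierstrassEta L ω) z := by
      simpa using ((hasDerivAt_id z).const_mul (weierstrassEta L ω)).cexp
    have h1 : logDeriv (fun z ↦ weierstrassSigma L (z + ω)) z = weierstrassZeta L (z + ω) := by
      simp [weierstrassZeta, logDeriv_apply, deriv_comp_add_const]
    rw [h1, weierstrassZeta_add hω hz, logDeriv_mul (f := fun z ↦ exp (weierstrassEta L ω * z)) z
      (exp_ne_zero _) (weierstrassSigma_ne_zero hz) hexp.differentiableAt (hσ z), logDeriv_apply,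
      hexp.deriv, mul_div_cancel_left₀ _ (exp_ne_zero _), add_comm, weierstrassZeta]
  rw [logDeriv_eqOn_iff (by fun_prop) (by fun_prop) L.isClosed_lattice.isOpen_compl
    isPreconnected_compl_lattice
    (fun z hz ↦ mul_ne_zero (exp_ne_zero _) (weierstrassSigma_ne_zero hz))
    (fun z hz ↦ weierstrassSigma_ne_zero (add_period_notMem hω hz))] at hlog
  obtain ⟨C, hC, h⟩ := hlog
  refine ⟨C, hC, fun z ↦ ?_⟩
  have hdense : Dense ((L.lattice : Set ℂ)ᶜ) :=
    Set.Countable.dense_compl ℝ (countable_of_Lindelof_of_discrete (X := L.lattice))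
  have := Continuous.ext_on hdense (f := fun z ↦ weierstrassSigma L (z + ω))
    (g := C • fun z ↦ exp (weierstrassEta L ω * z) * weierstrassSigma L z)
    (hσ.continuous.comp (by fun_prop)) (((by fun_prop : Continuous fun z ↦
      exp (weierstrassEta L ω * z)).mul hσ.continuous).const_smul C) h
  simpa [mul_assoc] using congr_fun this z

/-- At a period whose half is not a period, oddness of the sigma function determines the constant
in its quasi-periodicity. -/
lemma weierstrassSigma_add {ω : ℂ} (hω : ω ∈ L.lattice) (hω2 : ω / 2 ∉ L.lattice) (z : ℂ) :
    weierstrassSigma L (z + ω) =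
      -exp (weierstrassEta L ω * (z + ω / 2)) * weierstrassSigma L z := by
  obtain ⟨C, -, h⟩ := exists_weierstrassSigma_add hω
  have h0 := weierstrassSigma_ne_zero hω2
  have h1 := h (-(ω / 2))
  rw [show -(ω / 2) + ω = ω / 2 by ring, weierstrassSigma_neg] at h1
  have hC : C = -exp (weierstrassEta L ω * (ω / 2)) := by
    have h2 : C * exp (weierstrassEta L ω * -(ω / 2)) = -1 := by
      apply mul_right_cancel₀ h0
      linear_combination h1
    rw [mul_neg, exp_neg, ← div_eq_mul_inv, div_eq_iff (exp_ne_zero _)] at h2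
    simpa using h2
  rw [h z, hC, mul_add, exp_add]
  ring

lemma weierstrassSigma_eq_zero_iff {z : ℂ} : weierstrassSigma L z = 0 ↔ z ∈ L.lattice := by
  refine ⟨fun h ↦ not_not.1 fun hz ↦ weierstrassSigma_ne_zero hz h, fun hz ↦ ?_⟩
  obtain ⟨C, -, h⟩ := exists_weierstrassSigma_add hz
  simpa using h 0

lemma deriv_weierstrassSigma_ne_zero {ω : ℂ} (hω : ω ∈ L.lattice) :
    deriv (weierstrassSigma L) ω ≠ 0 := by
  obtain ⟨C, hC, h⟩ := exists_weierstrassSigma_add hω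
  have h1 := (((hasDerivAt_id (0 : ℂ)).const_mul (weierstrassEta L ω)).cexp.const_mul C).mul
    (differentiable_weierstrassSigma L 0).hasDerivAt
  have h2 : deriv (fun z ↦ weierstrassSigma L (z + ω)) 0 = C := by
    rw [funext h]
    exact h1.deriv.trans (by simp [deriv_weierstrassSigma_zero])
  rw [deriv_comp_add_const, zero_add] at h2
  rwa [h2]

/-- Legendre's relation `η(ω₁) ω₂ - η(ω₂) ω₁ = ± 2πi`, modulo `4πi`: it results from comparing the
quasi-periodicity of the sigma function at `ω₁`, `ω₂` and `ω₁ + ω₂`. -/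
lemma exp_legendre (L : PeriodPair) :
    exp ((weierstrassEta L L.ω₁ * L.ω₂ - weierstrassEta L L.ω₂ * L.ω₁) / 2) = -1 := by
  have h1 := L.ω₁_mem_lattice
  have h2 := L.ω₂_mem_lattice
  have h12 : (L.ω₁ + L.ω₂) / 2 ∉ L.lattice := by
    have := (L.mul_ω₁_add_mul_ω₂_mem_lattice (α := 1 / 2) (β := 1 / 2)).not.mpr (by norm_num)
    convert! this using 2
    push_cast
    ring
  obtain ⟨z, hz⟩ : ∃ z, z ∉ L.lattice := ⟨_, L.ω₁_div_two_notMem_lattice⟩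
  have e := weierstrassSigma_add (add_mem h1 h2) h12 z
  rw [← add_assoc, weierstrassSigma_add h2 L.ω₂_div_two_notMem_lattice,
    weierstrassSigma_add h1 L.ω₁_div_two_notMem_lattice, ← mul_assoc] at e
  have e := mul_right_cancel₀ (weierstrassSigma_ne_zero hz) e
  rw [neg_mul_neg, ← exp_add, weierstrassEta_add h1 h2] at e
  set a := weierstrassEta L L.ω₁
  set b := weierstrassEta L L.ω₂
  -- the three exponents differ by `(b ω₁ - a ω₂) / 2`
  have e' : exp (b * (z + L.ω₁ + L.ω₂ / 2) + a * (z + L.ω₁ / 2)) =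
      exp ((a + b) * (z + (L.ω₁ + L.ω₂) / 2)) * exp (-((a * L.ω₂ - b * L.ω₁) / 2)) := by
    rw [← exp_add]
    ring_nf
  rw [e', mul_comm] at e
  have e := mul_right_cancel₀ (exp_ne_zero _) (e.trans (neg_one_mul _).symm)
  rw [exp_neg, inv_eq_iff_eq_inv] at e
  rw [e]
  norm_num

end

section

/-! ### Reality of the sigma function of a rectangular lattice -/

lemma weierstrassSigma_conj {L : PeriodPair} (hL : ∀ ω ∈ L.lattice, conj ω ∈ L.lattice) (z : ℂ) :
    weierstrassSigma L (conj z) = conj (weierstrassSigma L z) := by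
  let e : L.lattice ≃ L.lattice :=
    { toFun := fun ω ↦ ⟨conj (ω : ℂ), hL _ ω.2⟩
      invFun := fun ω ↦ ⟨conj (ω : ℂ), hL _ ω.2⟩
      left_inv := fun ω ↦ by simp
      right_inv := fun ω ↦ by simp }
  let e' : {ω : L.lattice // ω ≠ 0} ≃ {ω : L.lattice // ω ≠ 0} :=
    e.subtypeEquiv fun ω ↦ (e.injective.ne_iff' (Subtype.ext (map_zero conj))).symm
  have hfac (u : ℂ) : elementaryFactor (conj u) = conj (elementaryFactor u) := by
    simp [elementaryFactor, ← exp_conj, conj_ofNat]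
  rw [weierstrassSigma_eq, weierstrassSigma_eq, map_mul,
    (multipliable_elementaryFactor z).map_tprod (starRingEnd ℂ) continuous_conj, ← e'.tprod_eq]
  congr 2
  ext ω
  rw [← hfac]
  simp [e', e]

lemma weierstrassZeta_conj {L : PeriodPair} (hL : ∀ ω ∈ L.lattice, conj ω ∈ L.lattice) (z : ℂ) :
    weierstrassZeta L (conj z) = conj (weierstrassZeta L z) := by
  have h := ((differentiable_weierstrassSigma L z).hasDerivAt).conj_conj
  have h2 : conj ∘ weierstrassSigma L ∘ conj = weierstrassSigma L := by
    ext w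
    simp [weierstrassSigma_conj hL]
  rw [h2] at h
  rw [weierstrassZeta, weierstrassZeta, logDeriv_apply, logDeriv_apply, h.deriv,
    weierstrassSigma_conj hL, map_div₀]

variable {R : PeriodPair}

lemma IsRectangular.conj_tau (hR : IsRectangular R) : conj R.ω₂ = -R.ω₂ :=
  Complex.ext (by simp [hR.re_tau]) (by simp)

lemma IsRectangular.conj_mem (hR : IsRectangular R) {ω : ℂ} (hω : ω ∈ R.lattice) :
    conj ω ∈ R.lattice := by
  obtain ⟨m, n, rfl⟩ := PeriodPair.mem_lattice.1 hω
  exact PeriodPair.mem_lattice.2 ⟨m, -n, by simp [hR.conj_tau, hR.omega_one]⟩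

lemma IsRectangular.weierstrassEta_conj (hR : IsRectangular R) (ω : ℂ) :
    weierstrassEta R (conj ω) = conj (weierstrassEta R ω) := by
  have h (z : ℂ) := weierstrassZeta_conj (L := R) (fun _ ↦ hR.conj_mem) z
  have h2 : conj (R.ω₁ / 2) = R.ω₁ / 2 := by simp [hR.omega_one, conj_ofNat]
  have h3 : R.ω₁ / 2 + conj ω = conj (R.ω₁ / 2 + ω) := by rw [map_add, h2]
  rw [weierstrassEta, weierstrassEta, map_sub, ← h, ← h, h2, h3]

lemma exp_int_mul_legendre (L : PeriodPair) (n : ℤ) :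
    exp (n * ((weierstrassEta L L.ω₁ * L.ω₂ - weierstrassEta L L.ω₂ * L.ω₁) / 2)) = (-1) ^ n := by
  rw [exp_int_mul, exp_legendre]

lemma toTorus_eq_iff {L : PeriodPair} {z w : ℂ} :
    toTorus L z = toTorus L w ↔ z - w ∈ L.lattice :=
  Submodule.Quotient.eq _

lemma toTorus_surjective (L : PeriodPair) : Function.Surjective (toTorus L) :=
  Submodule.mkQ_surjective _

/-! ### Symmetries of the sigma quotient -/

lemma prod_weierstrassSigma_add {L : PeriodPair} {ω : ℂ} (hω : ω ∈ L.lattice)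
    (hω2 : ω / 2 ∉ L.lattice) (x : Fin 4 → ℂ) :
    ∏ k, weierstrassSigma L (x k + ω) =
      exp (weierstrassEta L ω * (∑ k, x k + 2 * ω)) * ∏ k, weierstrassSigma L (x k) := by
  have h : exp (weierstrassEta L ω * (∑ k, x k + 2 * ω)) =
      ∏ k, exp (weierstrassEta L ω * (x k + ω / 2)) := by
    rw [← exp_sum]
    congr 1
    simp only [Fin.sum_univ_four]
    ring
  simp_rw [weierstrassSigma_add hω hω2, neg_mul, h, ← Finset.prod_mul_distrib]
  simp [Finset.prod_neg, show (-1 : ℂ) ^ 4 = 1 by norm_num]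

/-- The numerator of the sigma quotient. -/
def sigmaNumerator (R : PeriodPair) (b : Fin 4 → ℂ) (z : ℂ) : ℂ :=
  ∏ k, weierstrassSigma R (z - conj (b k) - 1 / 2)

/-- The denominator of the sigma quotient. -/
def sigmaDenominator (R : PeriodPair) (b : Fin 4 → ℂ) (z : ℂ) : ℂ :=
  ∏ k, weierstrassSigma R (z - b k)

variable {b : Fin 4 → ℂ}

@[fun_prop]
lemma differentiable_sigmaNumerator : Differentiable ℂ (sigmaNumerator R b) :=
  Differentiable.fun_finsetProd fun _ _ ↦
    (differentiable_weierstrassSigma R).comp (by fun_prop)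

@[fun_prop]
lemma differentiable_sigmaDenominator : Differentiable ℂ (sigmaDenominator R b) :=
  Differentiable.fun_finsetProd fun _ _ ↦
    (differentiable_weierstrassSigma R).comp (by fun_prop)

lemma sigmaNumerator_eq_zero_iff {z : ℂ} :
    sigmaNumerator R b z = 0 ↔ ∃ k, toTorus R z = toTorus R (conj (b k) + 1 / 2) := by
  simp [sigmaNumerator, Finset.prod_eq_zero_iff, weierstrassSigma_eq_zero_iff, toTorus_eq_iff,
    sub_sub]

lemma sigmaDenominator_eq_zero_iff {z : ℂ} :
    sigmaDenominator R b z = 0 ↔ ∃ k, toTorus R z = toTorus R (b k) := by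
  simp [sigmaDenominator, Finset.prod_eq_zero_iff, weierstrassSigma_eq_zero_iff, toTorus_eq_iff]

lemma sigmaNumerator_ne_zero (hb : b ∈ admissibleParameters R) {z : ℂ}
    (hz : sigmaDenominator R b z = 0) : sigmaNumerator R b z ≠ 0 := by
  rw [ne_eq, sigmaNumerator_eq_zero_iff]
  obtain ⟨j, hj⟩ := sigmaDenominator_eq_zero_iff.1 hz
  rintro ⟨k, hk⟩
  exact hb.2.2 j k (hj.symm.trans hk)

lemma sigmaQuotient_eq (z : ℂ) : sigmaQuotient R b z =
    exp (-(weierstrassEta R 1 / 2) * (1 + ∑ k, ((b k).re : ℂ))) *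
      exp (-weierstrassEta R (∑ k, b k - ∑ k, (conj (b k) + 1 / 2)) * z) *
      (sigmaNumerator R b z / sigmaDenominator R b z) := rfl

lemma sum_eq_of_mem_admissibleParameters {l : ℤ}
    (hl : I * ∑ k, ((b k).im : ℂ) = (2 * (l : ℂ) + 1) / 2 * R.ω₂) :
    ∑ k, b k = ∑ k, ((b k).re : ℂ) + (2 * l + 1) / 2 * R.ω₂ := by
  rw [← hl, Finset.mul_sum, ← Finset.sum_add_distrib]
  exact Finset.sum_congr rfl fun k _ ↦ by rw [mul_comm, re_add_im]

lemma sum_conj_eq_of_mem_admissibleParameters {l : ℤ} (hR : IsRectangular R)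
    (hl : I * ∑ k, ((b k).im : ℂ) = (2 * (l : ℂ) + 1) / 2 * R.ω₂) :
    ∑ k, conj (b k) = ∑ k, ((b k).re : ℂ) - (2 * l + 1) / 2 * R.ω₂ := by
  rw [← map_sum, sum_eq_of_mem_admissibleParameters hl]
  simp [hR.conj_tau, conj_ofNat]
  ring

lemma sum_sub_sum_eq_of_mem_admissibleParameters {l : ℤ} (hR : IsRectangular R)
    (hl : I * ∑ k, ((b k).im : ℂ) = (2 * (l : ℂ) + 1) / 2 * R.ω₂) :
    ∑ k, b k - ∑ k, (conj (b k) + 1 / 2) = ((-2 : ℤ) : ℂ) * R.ω₁ + (2 * l + 1 : ℤ) * R.ω₂ := by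
  rw [Finset.sum_add_distrib, sum_eq_of_mem_admissibleParameters hl,
    sum_conj_eq_of_mem_admissibleParameters hR hl, hR.omega_one]
  simp
  ring

/-- Under `z ↦ z + ω` the sigma quotient is multiplied by an exponential which measures the
alternating pairing `η(ω) ω₀ - η(ω₀) ω`. -/
lemma sigmaQuotient_add {ω : ℂ} (hω : ω ∈ R.lattice) (hω2 : ω / 2 ∉ R.lattice) (z : ℂ) :
    sigmaQuotient R b (z + ω) =
      exp (weierstrassEta R ω * (∑ k, b k - ∑ k, (conj (b k) + 1 / 2)) -
        weierstrassEta R (∑ k, b k - ∑ k, (conj (b k) + 1 / 2)) * ω) * sigmaQuotient R b z := by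
  have hN : sigmaNumerator R b (z + ω) =
      exp (weierstrassEta R ω * (∑ k, (z - conj (b k) - 1 / 2) + 2 * ω)) *
        sigmaNumerator R b z := by
    rw [sigmaNumerator, sigmaNumerator, ← prod_weierstrassSigma_add hω hω2]
    exact Finset.prod_congr rfl fun k _ ↦ by ring_nf
  have hD : sigmaDenominator R b (z + ω) =
      exp (weierstrassEta R ω * (∑ k, (z - b k) + 2 * ω)) * sigmaDenominator R b z := by
    rw [sigmaDenominator, sigmaDenominator, ← prod_weierstrassSigma_add hω hω2]
    exact Finset.prod_congr rfl fun k _ ↦ by ring_nf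
  rw [sigmaQuotient_eq, sigmaQuotient_eq, hN, hD, mul_div_mul_comm, ← exp_sub]
  generalize weierstrassEta R (∑ k, b k - ∑ k, (conj (b k) + 1 / 2)) = E
  generalize sigmaNumerator R b z / sigmaDenominator R b z = q
  generalize exp (-(weierstrassEta R 1 / 2) * (1 + ∑ k, ((b k).re : ℂ))) = c
  have : exp (-E * (z + ω)) * exp (weierstrassEta R ω * (∑ k, (z - conj (b k) - 1 / 2) + 2 * ω) -
      weierstrassEta R ω * (∑ k, (z - b k) + 2 * ω)) =
      exp (weierstrassEta R ω * (∑ k, b k - ∑ k, (conj (b k) + 1 / 2)) - E * ω) *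
        exp (-E * z) := by
    rw [← exp_add, ← exp_add]
    congr 1
    simp only [Fin.sum_univ_four]
    ring
  linear_combination c * q * this

lemma sigmaQuotient_periodic (hR : IsRectangular R) (hb : b ∈ admissibleParameters R) {z w : ℂ}
    (h : toTorus R z = toTorus R w) : sigmaQuotient R b z = sigmaQuotient R b w := by
  obtain ⟨l, hl⟩ := hb.2.1
  have h0 := sum_sub_sum_eq_of_mem_admissibleParameters hR hl
  have h1 (z : ℂ) : sigmaQuotient R b (z + R.ω₁) = sigmaQuotient R b z := by
    rw [sigmaQuotient_add R.ω₁_mem_lattice R.ω₁_div_two_notMem_lattice, h0,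
      weierstrassEta_zsmul_add_zsmul _ _ R.ω₁_mem_lattice R.ω₂_mem_lattice]
    have := exp_int_mul_legendre R (2 * (2 * l + 1))
    rw [zpow_mul] at this
    convert! one_mul _
    convert! this using 2
    · push_cast; ring
    · simp
  have h2 (z : ℂ) : sigmaQuotient R b (z + R.ω₂) = sigmaQuotient R b z := by
    rw [sigmaQuotient_add R.ω₂_mem_lattice R.ω₂_div_two_notMem_lattice, h0,
      weierstrassEta_zsmul_add_zsmul _ _ R.ω₁_mem_lattice R.ω₂_mem_lattice]
    have := exp_int_mul_legendre R (2 * 2)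
    convert! one_mul _
    convert! this using 2
    · push_cast; ring
    · norm_num
  rw [toTorus_eq_iff] at h
  obtain ⟨m, n, hmn⟩ := PeriodPair.mem_lattice.1 h
  have p1 : Function.Periodic (sigmaQuotient R b) (m * R.ω₁) := Function.Periodic.int_mul h1 m
  have p2 : Function.Periodic (sigmaQuotient R b) (n * R.ω₂) := Function.Periodic.int_mul h2 n
  rw [← p2 w, ← p1 (w + n * R.ω₂)]
  congr 1
  linear_combination -hmn

lemma sigmaMap_periodic (hR : IsRectangular R) (hb : b ∈ admissibleParameters R) {z w : ℂ}
    (h : toTorus R z = toTorus R w) : sigmaMap R b z = sigmaMap R b w := by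
  rw [sigmaMap, sigmaMap, h, sigmaQuotient_periodic hR hb h]

lemma sigmaMap_of_eq_zero {z : ℂ} (hz : sigmaDenominator R b z = 0) :
    sigmaMap R b z = OnePoint.infty :=
  if_pos (sigmaDenominator_eq_zero_iff.1 hz)

lemma sigmaMap_of_ne_zero {z : ℂ} (hz : sigmaDenominator R b z ≠ 0) :
    sigmaMap R b z = ((sigmaQuotient R b z : ℂ) : OnePoint ℂ) :=
  if_neg (sigmaDenominator_eq_zero_iff.not.1 hz)

lemma sigmaNumerator_conj_add_half (hR : IsRectangular R) (z : ℂ) :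
    sigmaNumerator R b (conj z + 1 / 2) = conj (sigmaDenominator R b z) := by
  rw [sigmaNumerator, sigmaDenominator, map_prod]
  refine Finset.prod_congr rfl fun k _ ↦ ?_
  rw [← weierstrassSigma_conj fun _ ↦ hR.conj_mem, map_sub]
  ring_nf

lemma sigmaDenominator_conj_add_half (hR : IsRectangular R) (z : ℂ) :
    sigmaDenominator R b (conj z + 1 / 2) =
      conj (exp (weierstrassEta R 1 * (∑ k, (z - conj (b k) - 1 / 2) + 2 * 1)) *
        sigmaNumerator R b z) := by
  have h1 := R.ω₁_mem_lattice
  have h2 := R.ω₁_div_two_notMem_lattice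
  rw [hR.omega_one] at h1 h2
  rw [sigmaNumerator, ← prod_weierstrassSigma_add h1 h2, sigmaDenominator, map_prod]
  refine Finset.prod_congr rfl fun k _ ↦ ?_
  rw [← weierstrassSigma_conj fun _ ↦ hR.conj_mem]
  congr 1
  simp [conj_ofNat]
  ring

/-- The sigma quotient is carried to its antipode by `z ↦ conj z + 1/2`. The normalizing constant
is chosen so that only the Legendre exponential remains, and it is `-1` because
`∑ Im b_k` is an odd multiple of `Im τ / 2`. -/
lemma sigmaQuotient_conj_add_half (hR : IsRectangular R) (hb : b ∈ admissibleParameters R) {z : ℂ}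
    (hN : sigmaNumerator R b z ≠ 0) (hD : sigmaDenominator R b z ≠ 0) :
    sigmaQuotient R b (conj z + 1 / 2) * conj (sigmaQuotient R b z) = -1 := by
  obtain ⟨l, hl⟩ := hb.2.1
  have h0 := sum_sub_sum_eq_of_mem_admissibleParameters hR hl
  have hc := sum_eq_of_mem_admissibleParameters hl
  have hA : conj (weierstrassEta R 1) = weierstrassEta R 1 := by
    rw [← hR.weierstrassEta_conj, map_one]
  have hB : conj (weierstrassEta R R.ω₂) = -weierstrassEta R R.ω₂ := by
    rw [← hR.weierstrassEta_conj, hR.conj_tau]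
    have := weierstrassEta_zsmul_add_zsmul 0 (-1) R.ω₁_mem_lattice R.ω₂_mem_lattice
    simpa using this
  have hleg := exp_int_mul_legendre R (2 * l + 1)
  rw [zpow_add₀ (by norm_num), zpow_mul, zpow_one, hR.omega_one] at hleg
  norm_num at hleg
  rw [sigmaQuotient_eq, sigmaQuotient_eq, sigmaNumerator_conj_add_half hR,
    sigmaDenominator_conj_add_half hR, h0,
    weierstrassEta_zsmul_add_zsmul _ _ R.ω₁_mem_lattice R.ω₂_mem_lattice, hR.omega_one]
  have hre : conj (∑ k, ((b k).re : ℂ)) = ∑ k, ((b k).re : ℂ) := by simp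
  have hsum : ∑ k, (z - conj (b k) - 1 / 2) = 4 * z - conj (∑ k, b k) - 2 := by
    rw [map_sum]
    simp only [Fin.sum_univ_four]
    ring
  rw [hsum, hc]
  have hN' : conj (sigmaNumerator R b z) ≠ 0 := by simpa using hN
  have hD' : conj (sigmaDenominator R b z) ≠ 0 := by simpa using hD
  simp only [map_mul, map_div₀, ← exp_conj, map_neg, map_add, map_sub, map_one, map_ofNat, hre,
    hA, hB, hR.conj_tau, map_intCast]
  generalize conj (sigmaNumerator R b z) = N at *
  generalize conj (sigmaDenominator R b z) = D at *
  generalize weierstrassEta R 1 = A at *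
  generalize weierstrassEta R R.ω₂ = B at *
  generalize ∑ k, ((b k).re : ℂ) = s at *
  generalize conj z = w at *
  have key (e₁ e₂ e₃ e₄ e₅ : ℂ) : exp e₁ * exp e₂ * (D / (exp e₃ * N)) *
      (exp e₄ * exp e₅ * (N / D)) = exp (e₁ + e₂ - e₃ + e₄ + e₅) := by
    simp only [exp_add, exp_sub]
    field_simp
  rw [key, ← hleg]
  congr 1
  push_cast
  ring

lemma sigmaMap_conj_add_half (hR : IsRectangular R) (hb : b ∈ admissibleParameters R) (z : ℂ) :
    sigmaMap R b (conj z + 1 / 2) = sphereAntipode (sigmaMap R b z) := by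
  have hD' : sigmaDenominator R b (conj z + 1 / 2) = 0 ↔ sigmaNumerator R b z = 0 := by
    rw [sigmaDenominator_conj_add_half hR]
    simp
  by_cases hD : sigmaDenominator R b z = 0
  · have hN := sigmaNumerator_ne_zero hb hD
    rw [sigmaMap_of_eq_zero hD, sigmaMap_of_ne_zero (hD'.not.2 hN), sigmaQuotient_eq,
      sigmaNumerator_conj_add_half hR, hD]
    simp [sphereAntipode]
  · rw [sigmaMap_of_ne_zero hD]
    by_cases hN : sigmaNumerator R b z = 0
    · rw [sigmaMap_of_eq_zero (hD'.2 hN), sigmaQuotient_eq, hN]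
      simp [sphereAntipode]
    · have h := sigmaQuotient_conj_add_half hR hb hN hD
      have h0 : sigmaQuotient R b z ≠ 0 := by
        intro h0
        simp [h0] at h
      have h1 : conj (sigmaQuotient R b z) ≠ 0 := by simpa using h0
      rw [sigmaMap_of_ne_zero (hD'.not.2 hN), eq_div_of_mul_eq h1 h]
      simp [sphereAntipode, h0, neg_div]

/-! ### Poles of the sigma quotient -/

/-- The sigma map is a holomorphic map to the Riemann sphere. -/
lemma exists_analyticAt_sigmaMap (hb : b ∈ admissibleParameters R) (z₀ : ℂ) :
    ∃ F : ℂ → ℂ, AnalyticAt ℂ F z₀ ∧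
      ((∀ᶠ z in 𝓝 z₀, sigmaMap R b z = ((F z : ℂ) : OnePoint ℂ)) ∨
        (∀ᶠ z in 𝓝 z₀, sigmaMap R b z = sphereInv ((F z : ℂ) : OnePoint ℂ))) := by
  have hexp (a c : ℂ) : Differentiable ℂ fun z ↦ exp a * exp (c * z) := by fun_prop
  by_cases hD : sigmaDenominator R b z₀ = 0
  · have hN := sigmaNumerator_ne_zero hb hD
    refine ⟨fun z ↦ (sigmaQuotient R b z)⁻¹, ?_, .inr ?_⟩
    · have : (fun z ↦ (sigmaQuotient R b z)⁻¹) = fun z ↦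
          (exp (-(weierstrassEta R 1 / 2) * (1 + ∑ k, ((b k).re : ℂ))) *
          exp (-weierstrassEta R (∑ k, b k - ∑ k, (conj (b k) + 1 / 2)) * z))⁻¹ *
          (sigmaDenominator R b z / sigmaNumerator R b z) := by
        ext z
        rw [sigmaQuotient_eq, mul_inv, inv_div]
      rw [this]
      exact (((hexp _ _).analyticAt z₀).inv (by simp)).mul
        ((differentiable_sigmaDenominator.analyticAt z₀).div
          (differentiable_sigmaNumerator.analyticAt z₀) hN)
    · filter_upwards [differentiable_sigmaNumerator.continuous.continuousAt.eventually_ne hN]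
        with z hz
      by_cases hDz : sigmaDenominator R b z = 0
      · rw [sigmaMap_of_eq_zero hDz, sigmaQuotient_eq, hDz]
        simp [sphereInv]
      · have h0 : sigmaQuotient R b z ≠ 0 := by
          rw [sigmaQuotient_eq]
          simp [hz, hDz]
        rw [sigmaMap_of_ne_zero hDz]
        simp [sphereInv, h0]
  · refine ⟨sigmaQuotient R b, ?_, .inl ?_⟩
    · exact ((hexp _ _).analyticAt z₀).mul ((differentiable_sigmaNumerator.analyticAt z₀).div
        (differentiable_sigmaDenominator.analyticAt z₀) hD)
    · filter_upwards [differentiable_sigmaDenominator.continuous.continuousAt.eventually_ne hD]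
        with z hz using sigmaMap_of_ne_zero hz

open Classical in
lemma meromorphicOrderAt_weierstrassSigma_sub (a z₀ : ℂ) :
    meromorphicOrderAt (fun z ↦ weierstrassSigma R (z - a)) z₀ =
      ((if toTorus R z₀ = toTorus R a then 1 else 0 : ℤ) : WithTop ℤ) := by
  have hd : Differentiable ℂ fun z ↦ weierstrassSigma R (z - a) :=
    (differentiable_weierstrassSigma R).comp (by fun_prop)
  have ha := hd.analyticAt z₀
  rw [ha.meromorphicOrderAt_eq]
  split_ifs with h
  · rw [toTorus_eq_iff] at h
    rw [ha.analyticOrderAt_eq_one_of_zero_deriv_ne_zero (weierstrassSigma_eq_zero_iff.2 h)]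
    · rfl
    · rw [deriv_comp_sub_const]
      exact deriv_weierstrassSigma_ne_zero h
  · rw [toTorus_eq_iff] at h
    rw [ha.analyticOrderAt_eq_zero.2 (weierstrassSigma_ne_zero h)]
    rfl

open Classical in
/-- The order of the pole of the sigma quotient at a point is the number of parameters congruent
to that point: there the numerator does not vanish, and the sigma function has simple zeros. -/
lemma toNat_neg_meromorphicOrderAt_sigmaQuotient (hb : b ∈ admissibleParameters R) (z₀ : ℂ) :
    (-(meromorphicOrderAt (sigmaQuotient R b) z₀).untop₀).toNat =
      ∑ k, if toTorus R z₀ = toTorus R (b k) then 1 else 0 := by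
  have hexp (a c : ℂ) : Differentiable ℂ fun z ↦ exp a * exp (c * z) := by fun_prop
  have hq : sigmaQuotient R b = fun z ↦
      ((exp (-(weierstrassEta R 1 / 2) * (1 + ∑ k, ((b k).re : ℂ))) *
        exp (-weierstrassEta R (∑ k, b k - ∑ k, (conj (b k) + 1 / 2)) * z)) *
        sigmaNumerator R b z) * (sigmaDenominator R b z)⁻¹ := by
    ext z
    rw [sigmaQuotient_eq, ← mul_div_assoc, ← div_eq_mul_inv]
  have hG := ((hexp (-(weierstrassEta R 1 / 2) * (1 + ∑ k, ((b k).re : ℂ)))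
    (-weierstrassEta R (∑ k, b k - ∑ k, (conj (b k) + 1 / 2)))).mul
      (differentiable_sigmaNumerator (R := R) (b := b))).analyticAt z₀
  have hDa := (differentiable_sigmaDenominator (R := R) (b := b)).analyticAt z₀
  by_cases hD : sigmaDenominator R b z₀ = 0
  · have hN := sigmaNumerator_ne_zero hb hD
    have hord : meromorphicOrderAt (sigmaDenominator R b) z₀ =
        ((∑ k, if toTorus R z₀ = toTorus R (b k) then 1 else 0 : ℤ) : WithTop ℤ) := by
      have : sigmaDenominator R b = fun z ↦ ∏ k, weierstrassSigma R (z - b k) := rfl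
      rw [this, meromorphicOrderAt_fun_prod]
      · simp_rw [meromorphicOrderAt_weierstrassSigma_sub]
        exact (WithTop.coe_sum _ _).symm
      · exact fun k _ ↦ (((differentiable_weierstrassSigma R).comp
          (by fun_prop : Differentiable ℂ fun z ↦ z - b k)).analyticAt z₀).meromorphicAt
    have h1 : meromorphicOrderAt (sigmaQuotient R b) z₀ =
        meromorphicOrderAt (sigmaDenominator R b)⁻¹ z₀ := by
      rw [hq]
      exact meromorphicOrderAt_mul_of_ne_zero hG
        (mul_ne_zero (mul_ne_zero (exp_ne_zero _) (exp_ne_zero _)) hN)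
    rw [h1, meromorphicOrderAt_inv, hord, ← WithTop.LinearOrderedAddCommGroup.coe_neg,
      WithTop.untop₀_coe, neg_neg]
    rw [← Int.toNat_natCast (∑ k, if toTorus R z₀ = toTorus R (b k) then 1 else 0)]
    push_cast
    rfl
  · have h0 : 0 ≤ meromorphicOrderAt (sigmaQuotient R b) z₀ := by
      rw [hq]
      exact (hG.mul (hDa.inv hD)).meromorphicOrderAt_nonneg
    have h1 : ∀ k, toTorus R z₀ ≠ toTorus R (b k) := by
      simpa using sigmaDenominator_eq_zero_iff.not.1 hD
    simp [h1, WithTop.untop₀_nonneg.2 h0]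

end

section

/-! ### Antiholomorphic maps between tori -/

lemma eventually_eq_of_eventually_mem_lattice {L : PeriodPair} {u : ℂ → ℂ} {w₀ : ℂ}
    (hu : ContinuousAt u w₀) (h : ∀ᶠ w in 𝓝 w₀, u w ∈ L.lattice) :
    ∀ᶠ w in 𝓝 w₀, u w = u w₀ := by
  filter_upwards [h, hu (L.compl_lattice_sdiff_singleton_mem_nhds (u w₀))] with w h1 h2
  by_contra h3
  exact h2 ⟨h1, h3⟩

/-- `F` is a holomorphic lift of the antiholomorphic map `f` at the conjugate variable `w`. -/
def IsAntiLiftAt {L L' : PeriodPair} (f : Torus L → Torus L') (F : ℂ → ℂ) (w : ℂ) : Prop :=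
  AnalyticAt ℂ F w ∧ ∀ᶠ v in 𝓝 w, f (toTorus L (conj v)) = toTorus L' (F v)

lemma IsAntiLiftAt.eventually {L L' : PeriodPair} {f : Torus L → Torus L'} {F : ℂ → ℂ} {w : ℂ}
    (h : IsAntiLiftAt f F w) : ∀ᶠ v in 𝓝 w, IsAntiLiftAt f F v :=
  h.1.eventually_analyticAt.and h.2.eventually_nhds

lemma IsAntiLiftAt.deriv_eq {L L' : PeriodPair} {f : Torus L → Torus L'} {F G : ℂ → ℂ} {w : ℂ}
    (hF : IsAntiLiftAt f F w) (hG : IsAntiLiftAt f G w) : deriv F w = deriv G w := by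
  have h := eventually_eq_of_eventually_mem_lattice (L := L') (u := fun v ↦ F v - G v)
    (hF.1.continuousAt.sub hG.1.continuousAt) (by
      filter_upwards [hF.2, hG.2] with v h1 h2
      exact toTorus_eq_iff.1 (h1.symm.trans h2))
  have h1 : deriv (fun v ↦ F v - G v) w = 0 := by
    rw [EventuallyEq.deriv_eq (f := fun _ ↦ F w - G w) h, deriv_const]
  have h2 := deriv_fun_sub hF.1.differentiableAt hG.1.differentiableAt
  exact sub_eq_zero.1 (h2.symm.trans h1)

lemma IsAntiholomorphicTorusMap.exists_isAntiLiftAt {L L' : PeriodPair} {f : Torus L → Torus L'}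
    (hf : IsAntiholomorphicTorusMap f) (w : ℂ) : ∃ F, IsAntiLiftAt f F w := by
  obtain ⟨F, hF, h⟩ := hf (conj w)
  rw [conj_conj] at hF
  refine ⟨F, hF, ?_⟩
  have := (continuous_conj.tendsto w).eventually h
  simpa using this

/-- An entire function with a full lattice of periods is constant: its values are those on a
bounded fundamental domain. The periods are `conj ω`, `ω ∈ Γ`, as the function is one of the
conjugate variable. -/
lemma apply_eq_apply_of_periodic {L : PeriodPair} {d : ℂ → ℂ} (hd : Differentiable ℂ d)
    (hper : ∀ ω ∈ L.lattice, ∀ z, d (z + conj ω) = d z) (z w : ℂ) : d z = d w := by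
  refine hd.apply_eq_apply_of_bounded ?_ z w
  have hb := ZSpan.fundamentalDomain_isBounded L.basis
  have hc := (hb.isCompact_closure.image (hd.continuous.comp continuous_conj)).isBounded
  refine hc.subset ?_
  rintro _ ⟨v, rfl⟩
  refine ⟨ZSpan.fract L.basis (conj v), subset_closure (ZSpan.fract_mem_fundamentalDomain _ _), ?_⟩
  have hfl : (ZSpan.floor L.basis (conj v) : ℂ) ∈ L.lattice := by
    rw [L.lattice_eq_span_range_basis]
    exact (ZSpan.floor L.basis (conj v)).2
  rw [Function.comp_apply, ← hper _ hfl, ← map_add, ZSpan.fract_apply]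
  simp

/-- An antiholomorphic map between tori is affine: the derivative of its local lifts is an entire
function with a lattice of periods, hence constant by Liouville's theorem. -/
lemma IsAntiholomorphicTorusMap.exists_affine {L L' : PeriodPair} {f : Torus L → Torus L'}
    (hf : IsAntiholomorphicTorusMap f) :
    ∃ a β : ℂ, ∀ z, f (toTorus L z) = toTorus L' (a * conj z + β) := by
  choose F hF using hf.exists_isAntiLiftAt
  set d : ℂ → ℂ := fun w ↦ deriv (F w) w
  have hev (w : ℂ) : d =ᶠ[𝓝 w] deriv (F w) := by
    filter_upwards [(hF w).eventually] with v hv using (hF v).deriv_eq hv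
  have hd : Differentiable ℂ d := fun w ↦
    (hev w).differentiableAt_iff.2 (hF w).1.deriv.differentiableAt
  have hper : ∀ ω ∈ L.lattice, ∀ z, d (z + conj ω) = d z := by
    intro ω hω w
    have hlift : IsAntiLiftAt f (fun v ↦ F (w + conj ω) (v + conj ω)) w := by
      refine ⟨(hF (w + conj ω)).1.fun_comp (f := fun v ↦ v + conj ω) (by fun_prop), ?_⟩
      have hc : Tendsto (fun v ↦ v + conj ω) (𝓝 w) (𝓝 (w + conj ω)) :=
        (continuous_id.add continuous_const).tendsto w
      filter_upwards [hc.eventually (hF (w + conj ω)).2] with v hv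
      rw [← hv]
      congr 1
      rw [toTorus_eq_iff]
      simpa using hω
    have := hlift.deriv_eq (hF w)
    rwa [deriv_comp_add_const] at this
  have hconst (w : ℂ) : d w = d 0 := apply_eq_apply_of_periodic hd hper w 0
  -- near each point a local lift minus `d 0 * w` has derivative zero
  have hloc : IsLocallyConstant fun w ↦ f (toTorus L (conj w)) - toTorus L' (d 0 * w) := by
    rw [IsLocallyConstant.iff_eventually_eq]
    intro w
    obtain ⟨ε, hε, hball⟩ := Metric.eventually_nhds_iff_ball.1
      (((hF w).1.eventually_analyticAt.and (hev w)).and (hF w).2)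
    filter_upwards [Metric.ball_mem_nhds w hε] with v hv
    have hw := Metric.mem_ball_self (x := w) hε
    have hda (x : ℂ) (hx : x ∈ Metric.ball w ε) :
        HasDerivAt (fun x ↦ F w x - d 0 * x) 0 x := by
      convert! (hball x hx).1.1.differentiableAt.hasDerivAt.sub
        ((hasDerivAt_id' x).const_mul (d 0)) using 1
      rw [← (hball x hx).1.2, hconst x]
      ring
    have h := Metric.isOpen_ball.is_const_of_deriv_eq_zero
      (convex_ball w ε).isPreconnected
      (fun x hx ↦ (hda x hx).differentiableAt.differentiableWithinAt)
      (fun x hx ↦ (hda x hx).deriv) hv hw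
    rw [(hball v hv).2, (hball w hw).2]
    have hsub (x y : ℂ) : toTorus L' x - toTorus L' y = toTorus L' (x - y) :=
      (map_sub L'.lattice.mkQ x y).symm
    rw [hsub, hsub]
    exact congrArg _ h
  obtain ⟨β, hβ⟩ := toTorus_surjective L' (f (toTorus L (conj 0)) - toTorus L' (d 0 * 0))
  refine ⟨d 0, β, fun z ↦ ?_⟩
  have h := hloc.apply_eq_of_preconnectedSpace (conj z) 0
  simp only [conj_conj] at h
  rw [← hβ, sub_eq_iff_eq_add'] at h
  rw [h]
  exact (map_add L'.lattice.mkQ _ _).symm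

/-! ### Normal form of a fixed point free antiholomorphic involution -/

/-- The real multiples of a nonzero complex number that lie in a lattice are the integer multiples
of one of them, as soon as one of them is nonzero. -/
lemma exists_generator_real_multiples {L : PeriodPair} {u : ℂ} (hu : u ≠ 0) {t₀ : ℝ}
    (ht₀ : t₀ ≠ 0) (h : (t₀ : ℂ) * u ∈ L.lattice) :
    ∃ p : ℝ, 0 < p ∧ ∀ t : ℝ, (t : ℂ) * u ∈ L.lattice ↔ ∃ m : ℤ, t = m * p := by
  let G : AddSubgroup ℝ :=
    { carrier := {t | (t : ℂ) * u ∈ L.lattice}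
      zero_mem' := by simp
      add_mem' := fun {s t} hs ht ↦ by
        simpa [add_mul] using add_mem (S := Submodule ℤ ℂ) hs ht
      neg_mem' := fun {s} hs ↦ by simpa using neg_mem (S := Submodule ℤ ℂ) hs }
  have hG (t : ℝ) : t ∈ G ↔ (t : ℂ) * u ∈ L.lattice := Iff.rfl
  have hcont : Tendsto (fun t : ℝ ↦ (t : ℂ) * u) (𝓝 0) (𝓝 0) := by
    have : Continuous fun t : ℝ ↦ (t : ℂ) * u := by fun_prop
    simpa using this.tendsto 0
  obtain ⟨ε, hε, hball⟩ := Metric.eventually_nhds_iff_ball.1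
    (hcont.eventually (L.compl_lattice_sdiff_singleton_mem_nhds 0))
  obtain ⟨p, hp⟩ := AddSubgroup.cyclic_of_isolated_zero (H := G) hε (by
    rw [Set.disjoint_left]
    intro t ht htε
    refine hball t (by simpa [abs_of_pos htε.1] using htε.2) ⟨ht, ?_⟩
    simpa using ⟨htε.1.ne', hu⟩)
  have hmem (t : ℝ) : (t : ℂ) * u ∈ L.lattice ↔ ∃ m : ℤ, t = m * p := by
    rw [← hG, hp, AddSubgroup.mem_closure_singleton]
    simp [eq_comm]
  have hp0 : p ≠ 0 := by
    rintro rfl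
    obtain ⟨m, hm⟩ := (hmem t₀).1 h
    exact ht₀ (by simpa using hm)
  rcases hp0.lt_or_gt with hneg | hpos
  · refine ⟨-p, neg_pos.2 hneg, fun t ↦ (hmem t).trans ?_⟩
    exact ⟨fun ⟨m, hm⟩ ↦ ⟨-m, by simp [hm]⟩, fun ⟨m, hm⟩ ↦ ⟨-m, by simp [hm]⟩⟩
  · exact ⟨p, hpos, hmem⟩

/-- The rectangular period pair `(1, i r)`. -/
def rectangularPeriodPair (r : ℝ) (hr : 0 < r) : PeriodPair where
  ω₁ := 1
  ω₂ := r * I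
  indep := by
    rw [LinearIndependent.pair_iff]
    intro s t h
    have h1 := congrArg Complex.re h
    have h2 := congrArg Complex.im h
    simp at h1 h2
    exact ⟨h1, h2.resolve_right hr.ne'⟩

lemma isRectangular_rectangularPeriodPair (r : ℝ) (hr : 0 < r) :
    IsRectangular (rectangularPeriodPair r hr) :=
  ⟨rfl, by simp [rectangularPeriodPair], by simpa [rectangularPeriodPair] using hr⟩

/-- Let `Λ` be a lattice `u⁻¹ Γ` that is stable under conjugation, and `β` a point such that
`2 Re β ∈ Λ` while no point of `Λ` has the real part of `β`. Then `Λ` is the rectangular lattice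
`ℤ p + ℤ i q`, where `Λ ∩ ℝ = ℤ p`, and `Re β` is an odd multiple of `p / 2`: otherwise some real
point of `Λ` would be `Re β`. No point of `Λ` has as real part an odd multiple of `p / 2`, as it
could be translated by a multiple of `p` to have the real part of `β`. -/
lemma exists_rectangular_generators {L : PeriodPair} {u β : ℂ} (hu : u ≠ 0)
    (hconj : ∀ x, u * x ∈ L.lattice → u * conj x ∈ L.lattice)
    (hβ : u * (β + conj β) ∈ L.lattice) (hre : ∀ x, u * x ∈ L.lattice → x.re ≠ β.re) :
    ∃ p q : ℝ, 0 < p ∧ 0 < q ∧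
      (∀ x, u * x ∈ L.lattice ↔ ∃ m n : ℤ, x = m * p + n * (q * I)) ∧
      ∃ n : ℤ, β.re = (2 * n + 1) / 2 * p := by
  have hβ0 : (2 * β.re : ℝ) ≠ 0 := by
    have := hre 0 (by simp)
    simpa [eq_comm] using this
  have hβ' : ((2 * β.re : ℝ) : ℂ) * u ∈ L.lattice := by
    rwa [add_conj, mul_comm] at hβ
  obtain ⟨p, hp, hP⟩ := exists_generator_real_multiples hu hβ0 hβ'
  have hP' (m : ℤ) : u * ((m : ℂ) * p) ∈ L.lattice := by
    have := (hP (m * p)).2 ⟨m, rfl⟩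
    rw [mul_comm]
    simpa using this
  obtain ⟨n, hn⟩ := (hP _).1 hβ'
  have hodd : ∀ x, u * x ∈ L.lattice → ∃ m : ℤ, x.re = m * p := by
    intro x hx
    have h2 : ((2 * x.re : ℝ) : ℂ) * u ∈ L.lattice := by
      have := add_mem hx (hconj x hx)
      rwa [← mul_add, add_conj, mul_comm] at this
    obtain ⟨m, hm⟩ := (hP _).1 h2
    rcases Int.even_or_odd' m with ⟨j, rfl | rfl⟩
    · exact ⟨j, by push_cast at hm; linarith⟩
    -- `2 Re x` cannot be an odd multiple of `p`, whatever the parity of `n`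
    rcases Int.even_or_odd' n with ⟨k, rfl | rfl⟩
    · refine absurd ?_ (hre _ (hP' k))
      push_cast at hn
      simp
      linarith
    · refine absurd ?_ (hre (x + ((k - j : ℤ) : ℂ) * p) (by
        rw [mul_add]; exact add_mem hx (hP' _)))
      push_cast at hn hm
      simp
      linarith
  have him : ∀ x, u * x ∈ L.lattice → (x.im : ℂ) * (u * I) ∈ L.lattice := by
    intro x hx
    obtain ⟨m, hm⟩ := hodd x hx
    have := sub_mem hx (hP' m)
    convert! this using 1
    have h1 : x = x.re + x.im * I := (re_add_im x).symm
    rw [hm] at h1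
    push_cast at h1
    linear_combination (-u) * h1
  -- a lattice is not contained in a real line, so it contains points off the real axis
  obtain ⟨y, hy, hy0⟩ : ∃ y, u * y ∈ L.lattice ∧ y.im ≠ 0 := by
    by_contra! hcon
    have e1 : u * (L.ω₁ / u) = L.ω₁ := mul_div_cancel₀ _ hu
    have e2 : u * (L.ω₂ / u) = L.ω₂ := mul_div_cancel₀ _ hu
    have i1 := hcon (L.ω₁ / u) (by rw [e1]; exact L.ω₁_mem_lattice)
    have i2 := hcon (L.ω₂ / u) (by rw [e2]; exact L.ω₂_mem_lattice)
    have r1 : L.ω₁ / u = ((L.ω₁ / u).re : ℂ) := Complex.ext rfl (by simpa using i1)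
    have r2 : L.ω₂ / u = ((L.ω₂ / u).re : ℂ) := Complex.ext rfl (by simpa using i2)
    rw [r1] at e1
    rw [r2] at e2
    have h := LinearIndependent.pair_iff.1 L.indep (L.ω₂ / u).re (-(L.ω₁ / u).re) (by
      simp only [real_smul, ofReal_neg]
      linear_combination (-((L.ω₂ / u).re : ℂ)) * e1 + ((L.ω₁ / u).re : ℂ) * e2)
    rw [neg_eq_zero] at h
    have h0 : L.ω₁ = 0 := by rw [← e1, h.2]; simp
    have := LinearIndependent.pair_iff.1 L.indep 1 0 (by simp [h0])
    exact one_ne_zero this.1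
  obtain ⟨q, hq, hQ⟩ := exists_generator_real_multiples (mul_ne_zero hu I_ne_zero) hy0 (him y hy)
  refine ⟨p, q, hp, hq, fun x ↦ ⟨fun hx ↦ ?_, ?_⟩, ?_⟩
  · obtain ⟨m, hm⟩ := hodd x hx
    obtain ⟨k, hk⟩ := (hQ x.im).1 (him x hx)
    refine ⟨m, k, ?_⟩
    conv_lhs => rw [← re_add_im x, hm, hk]
    push_cast
    ring
  · rintro ⟨m, k, rfl⟩
    rw [mul_add]
    refine add_mem (hP' m) ?_
    convert! (hQ (k * q)).2 ⟨k, rfl⟩ using 1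
    push_cast
    ring
  · rcases Int.even_or_odd' n with ⟨k, rfl | rfl⟩
    · refine absurd ?_ (hre _ (hP' k))
      push_cast at hn
      simp
      linarith
    · exact ⟨k, by push_cast at hn; linarith⟩

/-- In a suitable affine coordinate `κ z + c` the lattice is rectangular, and the involution
`z ↦ a conj z + β` is `w ↦ conj w + 1/2`. -/
lemma exists_rectangular_coordinate {L : PeriodPair} {a β : ℂ}
    (hmap : ∀ ω ∈ L.lattice, a * conj ω ∈ L.lattice)
    (hinv : ∀ z, a * conj (a * conj z + β) + β - z ∈ L.lattice)
    (hfix : ∀ z, a * conj z + β - z ∉ L.lattice) :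
    ∃ (R : PeriodPair) (κ c : ℂ), IsRectangular R ∧ κ ≠ 0 ∧
      (∀ z, κ * z ∈ R.lattice ↔ z ∈ L.lattice) ∧
      ∀ z, κ * (a * conj z + β) + c - (conj (κ * z + c) + 1 / 2) ∈ R.lattice := by
  have hβ : a * conj β + β ∈ L.lattice := by simpa using hinv 0
  have ha : a * conj a = 1 := by
    by_contra hne
    have hne' : a * conj a - 1 ≠ 0 := sub_ne_zero.2 hne
    refine L.ω₁_div_two_notMem_lattice ?_
    convert! sub_mem (hinv ((a * conj a - 1)⁻¹ * (L.ω₁ / 2))) hβ using 1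
    simp only [map_add, map_mul, conj_conj]
    linear_combination (-(L.ω₁ / 2)) * mul_inv_cancel₀ hne'
  -- the square root of `a` is the direction of the axis of the reflection
  obtain ⟨u, hu⟩ := IsAlgClosed.exists_pow_nat_eq a (n := 2) (by norm_num)
  have huu : u * conj u = 1 := by
    rw [← hu, map_pow, ← mul_pow, mul_conj] at ha
    rw [mul_conj]
    norm_cast at ha ⊢
    exact (pow_eq_one_iff_of_nonneg (normSq_nonneg u) two_ne_zero).1 ha
  have hu0 : u ≠ 0 := left_ne_zero_of_mul_eq_one huu
  obtain ⟨δ, rfl⟩ : ∃ δ, β = u * δ := ⟨β / u, (mul_div_cancel₀ _ hu0).symm⟩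
  have hau (x : ℂ) : a * conj (u * x) = u * conj x := by
    rw [← hu, map_mul]
    linear_combination (u * conj x) * huu
  obtain ⟨p, q, hp, hq, hlat, n, hn⟩ := exists_rectangular_generators (β := δ) hu0
    (fun x hx ↦ by rw [← hau]; exact hmap _ hx)
    (by rw [hau] at hβ; convert! hβ using 1; ring)
    (fun x hx hxδ ↦ by
      -- a lattice point with the real part of `δ` would be `conj v + δ - v` for an imaginary `v`
      refine hfix (u * (((δ.im - x.im) / 2 : ℝ) * I)) ?_
      rw [hau]
      convert! hx using 1
      rw [← mul_add, ← mul_sub]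
      congr 1
      rw [map_mul, conj_ofReal, conj_I]
      apply Complex.ext
      · simp [hxδ]
      · simp; ring)
  have hp0 : (p : ℂ) ≠ 0 := by exact_mod_cast hp.ne'
  have hr : 0 < q / p := div_pos hq hp
  -- the translation moves the axis so that the translation part of the involution becomes real
  refine ⟨rectangularPeriodPair (q / p) hr, (u * p)⁻¹, -(δ.im / (2 * p) * I),
    isRectangular_rectangularPeriodPair _ hr, inv_ne_zero (mul_ne_zero hu0 hp0), fun z ↦ ?_,
    fun z ↦ ?_⟩
  · obtain ⟨x, rfl⟩ : ∃ x, z = u * x := ⟨z / u, (mul_div_cancel₀ _ hu0).symm⟩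
    rw [hlat, PeriodPair.mem_lattice]
    refine exists_congr fun m ↦ exists_congr fun k ↦ ?_
    simp only [rectangularPeriodPair]
    push_cast
    rw [show (u * p)⁻¹ * (u * x) = x / p by field_simp, eq_div_iff hp0, eq_comm]
    field_simp
  · obtain ⟨x, rfl⟩ : ∃ x, z = u * x := ⟨z / u, (mul_div_cancel₀ _ hu0).symm⟩
    refine PeriodPair.mem_lattice.2 ⟨n, 0, ?_⟩
    have e1 : (u * p)⁻¹ * (u * x) = x / p := by field_simp
    have e2 : (u * p)⁻¹ * (u * conj x + u * δ) = (conj x + δ) / p := by field_simp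
    have e3 : δ = (2 * n + 1) / 2 * p + δ.im * I := by
      conv_lhs => rw [← re_add_im δ, hn]
      push_cast
      ring
    rw [hau, e1, e2]
    simp only [rectangularPeriodPair, map_add, map_div₀, conj_ofReal, map_neg, map_mul, conj_I,
      map_ofNat]
    generalize (δ.im : ℂ) = y at *
    rw [e3]
    push_cast
    field_simp
    ring

end

section

/-! ### Transport to the given torus -/

/-- The isomorphism of tori `[z] ↦ [κ z + c]`, where multiplication by `κ` carries one lattice onto
the other. -/
def affineTorusEquiv {L R : PeriodPair} (κ c : ℂ) (hκ : κ ≠ 0)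
    (h : ∀ z, κ * z ∈ R.lattice ↔ z ∈ L.lattice) : Torus L ≃ Torus R :=
  (Submodule.Quotient.equiv L.lattice R.lattice
    ((LinearEquiv.smulOfNeZero ℂ ℂ κ hκ).restrictScalars ℤ) (by
      ext w
      rw [Submodule.mem_map]
      constructor
      · rintro ⟨z, hz, rfl⟩
        exact (h z).2 hz
      · intro hw
        refine ⟨κ⁻¹ * w, (h _).1 ?_, ?_⟩
        · rwa [mul_inv_cancel_left₀ hκ]
        · exact mul_inv_cancel_left₀ hκ w)).toEquiv.trans (Equiv.addRight (toTorus R c))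

section

variable {L R : PeriodPair} {κ c : ℂ} {hκ : κ ≠ 0} {h : ∀ z, κ * z ∈ R.lattice ↔ z ∈ L.lattice}

lemma affineTorusEquiv_apply (z : ℂ) :
    affineTorusEquiv κ c hκ h (toTorus L z) = toTorus R (κ * z + c) :=
  (map_add R.lattice.mkQ (κ * z) c).symm

lemma affineTorusEquiv_symm_apply (w : ℂ) :
    (affineTorusEquiv κ c hκ h).symm (toTorus R w) = toTorus L (κ⁻¹ * (w - c)) := by
  rw [Equiv.symm_apply_eq, affineTorusEquiv_apply, mul_inv_cancel_left₀ hκ, sub_add_cancel]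

lemma isBiholomorphic_affineTorusEquiv : IsBiholomorphic (affineTorusEquiv κ c hκ h) :=
  ⟨fun z₀ ↦ ⟨fun z ↦ κ * z + c, by fun_prop, .of_forall affineTorusEquiv_apply⟩,
    fun w₀ ↦ ⟨fun w ↦ κ⁻¹ * (w - c), by fun_prop, .of_forall affineTorusEquiv_symm_apply⟩⟩

end

/-- The map of the torus `ℂ / Γ_R` to the Riemann sphere induced by the sigma quotient. -/
def torusSigmaMap (R : PeriodPair) (b : Fin 4 → ℂ) (p : Torus R) : OnePoint ℂ :=
  sigmaMap R b (Function.surjInv (toTorus_surjective R) p)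

variable {L R : PeriodPair} {b : Fin 4 → ℂ}

lemma torusSigmaMap_toTorus (hR : IsRectangular R) (hb : b ∈ admissibleParameters R) (z : ℂ) :
    torusSigmaMap R b (toTorus R z) = sigmaMap R b z :=
  sigmaMap_periodic hR hb (Function.surjInv_eq _ _)

lemma isMeromorphicOnTorus_of_eq_sigmaMap (hb : b ∈ admissibleParameters R) {κ c : ℂ}
    (hκ : κ ≠ 0) {g : Torus L → OnePoint ℂ}
    (hg : ∀ z, g (toTorus L z) = sigmaMap R b (κ * z + c)) : IsMeromorphicOnTorus g := by
  constructor
  · intro z₀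
    obtain ⟨F, hF, h⟩ := exists_analyticAt_sigmaMap hb (κ * z₀ + c)
    have hc : Tendsto (fun z ↦ κ * z + c) (𝓝 z₀) (𝓝 (κ * z₀ + c)) :=
      (by fun_prop : Continuous fun z ↦ κ * z + c).tendsto z₀
    refine ⟨fun z ↦ F (κ * z + c), hF.fun_comp (f := fun z ↦ κ * z + c) (by fun_prop), ?_⟩
    simp_rw [hg]
    exact h.imp (fun h ↦ hc.eventually h) (fun h ↦ hc.eventually h)
  -- the point `conj b_0 + 1/2` is not congruent to any parameter
  · refine ⟨toTorus L (κ⁻¹ * (conj (b 0) + 1 / 2 - c)), ?_⟩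
    rw [hg, mul_inv_cancel_left₀ hκ, sub_add_cancel, sigmaMap_of_ne_zero]
    · exact OnePoint.coe_ne_infty _
    · rw [ne_eq, sigmaDenominator_eq_zero_iff]
      rintro ⟨j, hj⟩
      exact hb.2.2 j 0 hj.symm

open Classical in
lemma poleOrder_of_eq_sigmaMap (hb : b ∈ admissibleParameters R) {κ c : ℂ}
    (hκ : κ ≠ 0) {g : Torus L → OnePoint ℂ}
    (hg : ∀ z, g (toTorus L z) = sigmaMap R b (κ * z + c)) (p : Torus L) :
    poleOrder g p = ∑ k, if toTorus R (κ * Quotient.out p + c) = toTorus R (b k) then 1 else 0 := by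
  -- the value `0` at poles agrees with division by zero in the sigma quotient
  have hpull : pullbackToPlane g = sigmaQuotient R b ∘ fun z ↦ κ * z + c := by
    ext z
    rw [pullbackToPlane, hg, Function.comp_apply]
    by_cases hD : sigmaDenominator R b (κ * z + c) = 0
    · rw [sigmaMap_of_eq_zero hD, sigmaQuotient_eq, hD, div_zero, mul_zero]
      rfl
    · rw [sigmaMap_of_ne_zero hD]
      rfl
  have hder : deriv (fun z ↦ κ * z + c) (Quotient.out p) = κ := by
    simp
  rw [poleOrder, hpull, meromorphicOrderAt_comp_of_deriv_ne_zero (by fun_prop) (by rwa [hder]),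
    toNat_neg_meromorphicOrderAt_sigmaQuotient hb]

lemma torusDegree_eq_four (hb : b ∈ admissibleParameters R) {κ c : ℂ} (hκ : κ ≠ 0)
    (h : ∀ z, κ * z ∈ R.lattice ↔ z ∈ L.lattice) {g : Torus L → OnePoint ℂ}
    (hg : ∀ z, g (toTorus L z) = sigmaMap R b (κ * z + c)) : torusDegree g = 4 := by
  classical
  let φ : Torus L ≃ Torus R := affineTorusEquiv κ c hκ h
  have hp (p : Torus L) (k : Fin 4) :
      toTorus R (κ * Quotient.out p + c) = toTorus R (b k) ↔ p = φ.symm (toTorus R (b k)) := by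
    rw [Equiv.eq_symm_apply, ← affineTorusEquiv_apply (hκ := hκ) (h := h)]
    have : toTorus L (Quotient.out p) = p := Quotient.out_eq p
    rw [this]
  simp_rw [torusDegree, poleOrder_of_eq_sigmaMap hb hκ hg, hp]
  rw [finsum_sum_comm]
  · have (k : Fin 4) :
        ∑ᶠ p : Torus L, (if p = φ.symm (toTorus R (b k)) then 1 else 0 : ℕ) = 1 := by
      rw [finsum_eq_single _ (φ.symm (toTorus R (b k))) fun p hp ↦ if_neg hp, if_pos rfl]
    simp [this]
  · intro k _
    refine (Set.finite_singleton (φ.symm (toTorus R (b k)))).subset fun p hp ↦ ?_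
    by_contra hne
    exact hp (if_neg hne)

lemma IsRectangular.admissibleParameters_nonempty (hR : IsRectangular R) :
    (admissibleParameters R).Nonempty := by
  have hr := hR.im_tau
  have hτ : R.ω₂ = R.ω₂.im * I := Complex.ext (by simp [hR.re_tau]) (by simp)
  -- all four parameters on the line `Im z = Im τ / 8`, whose sum has imaginary part `Im τ / 2`
  refine ⟨fun _ ↦ (R.ω₂.im / 8 : ℝ) * I, fun _ ↦ ⟨?_, ?_⟩, ⟨0, ?_⟩, fun _ _ h ↦ ?_⟩
  · simp
  · simp only [mem_Icc, mul_im, ofReal_re, ofReal_im, I_re, I_im]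
    constructor <;> linarith
  · conv_rhs => rw [hτ]
    simp
    ring
  · rw [toTorus_eq_iff] at h
    obtain ⟨m, n, hmn⟩ := PeriodPair.mem_lattice.1 h
    have := congrArg Complex.im hmn
    rw [map_mul, conj_ofReal, conj_I, hR.omega_one, hτ] at this
    simp at this
    have h4 : (n : ℝ) * 4 = 1 := by
      apply mul_right_cancel₀ hr.ne'
      linarith
    have : n * 4 = 1 := by exact_mod_cast h4
    omega

end

end

theorem mainTheorem9 (L : PeriodPair) (I : Torus L → Torus L)
    (hI : IsAntiholomorphicTorusMap I) (hinv : Function.Involutive I) (hfix : ∀ p, I p ≠ p) :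
    ∃ (R : PeriodPair) (φ : Torus L ≃ Torus R),
      IsRectangular R ∧ IsBiholomorphic φ ∧
      (∀ z : ℂ, φ (I (φ.symm (toTorus R z))) = toTorus R (conj z + 1 / 2)) ∧
      (admissibleParameters R).Nonempty ∧
      ∃ g : admissibleParameters R → Torus L → OnePoint ℂ,
        ∀ b : admissibleParameters R,
          IsMeromorphicOnTorus (g b) ∧
          torusDegree (g b) = 4 ∧
          (∀ p, g b (I p) = sphereAntipode (g b p)) ∧
          ∀ z : ℂ, g b (φ.symm (toTorus R z)) = sigmaMap R b z := by
  obtain ⟨a, β, hab⟩ := hI.exists_affine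
  obtain ⟨R, κ, c, hR, hκ, hlat, hcoord⟩ := exists_rectangular_coordinate (L := L) (a := a) (β := β)
    (fun ω hω ↦ by
      have h : toTorus L ω = toTorus L 0 := toTorus_eq_iff.2 (by simpa using hω)
      have h2 := hab ω
      rw [h, hab 0, toTorus_eq_iff] at h2
      simpa using neg_mem h2)
    (fun z ↦ by
      rw [← toTorus_eq_iff, ← hab, ← hab]
      exact hinv _)
    (fun z hz ↦ by
      rw [← toTorus_eq_iff, ← hab] at hz
      exact hfix _ hz)
  let φ : Torus L ≃ Torus R := affineTorusEquiv κ c hκ hlat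
  have hφ (z : ℂ) : φ (toTorus L z) = toTorus R (κ * z + c) := affineTorusEquiv_apply z
  have hφI (z : ℂ) : φ (I (toTorus L z)) = toTorus R (conj (κ * z + c) + 1 / 2) := by
    rw [hab, hφ, toTorus_eq_iff]
    exact hcoord z
  refine ⟨R, φ, hR, isBiholomorphic_affineTorusEquiv, fun w ↦ ?_,
    hR.admissibleParameters_nonempty, fun b p ↦ torusSigmaMap R b (φ p), fun b ↦ ?_⟩
  · rw [affineTorusEquiv_symm_apply, hφI, mul_inv_cancel_left₀ hκ, sub_add_cancel]
  · have hg (z : ℂ) : torusSigmaMap R b (φ (toTorus L z)) = sigmaMap R b (κ * z + c) := by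
      rw [hφ, torusSigmaMap_toTorus hR b.2]
    refine ⟨isMeromorphicOnTorus_of_eq_sigmaMap b.2 hκ hg, torusDegree_eq_four b.2 hκ hlat hg,
      fun p ↦ ?_, fun w ↦ ?_⟩
    · obtain ⟨z, rfl⟩ := toTorus_surjective L p
      beta_reduce
      rw [hg, hφI, torusSigmaMap_toTorus hR b.2, sigmaMap_conj_add_half hR b.2]
    · beta_reduce
      rw [Equiv.apply_symm_apply, torusSigmaMap_toTorus hR b.2]
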